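/- Let $N$ be a natural number, and let $\mathcal H^{N-1}$ be the $(N-1)$-dimensional Hausdorff measure on $\mathbb R^N$. For an open set $\Omega\subset\mathbb R^N$ we use the following classes of functions $f:\Omega\to\mathbb R$. - $f\in DC(\Omega)$ if $f$ is locally in $\Omega$ a difference of two semiconcave functions, where a function $g$ is semiconcave if locally $g-C\|\cdot\|^2$ is concave for some constant $C$. - $f\in C_w(\Omega)$ if there is a set $S$, the union of an increasing sequence of sets of finite $\mathcal H^{N-1}$ measure, such that $f|_{\Omega\setminus S}$ is continuous and locally bounded in $\Omega$ (each $x\in\Omega$ has a ball $B_r(x)\Subset\Omega$ with $\sup_{B_r(x)\setminus S}|f|<\infty$). If $S$ can be chosen with $\mathcal H^{N-1}(S)=0$, then $f\in C_{w,o}(\Omega)$. - $f\in DC_0(\Omega)$ if $f\in DC(\Omega)$ and all first partial derivatives of $f$ (given an arbitrary value where $f$ is not differentiable) lie in $C_{w,o}(\Omega)$, with a common exceptional set. - $f\in BV_{loc}(\Omega)$ if $f\in L^1_{loc}(\Omega)$ and there are signed Radon measures $\partial f/\partial x_i$ on $\Omega$ (of finite variation on compact subsets of $\Omega$) such that $\int_\Omega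 f\,\frac{\partial\varphi}{\partial x_i}\,dx=-\int_\Omega\varphi\,d\frac{\partial f}{\partial x_i}$ for all $i$ and all Lipschitz functions $\varphi$ with compact support in $\Omega$. - $\mathcal{BV}(\Omega)=BV_{loc}(\Omega)\cap C_w(\Omega)$. Let $\hat U,\hat V\subset\mathbb R^N$ be open, and let $F=(F_1,\dots,F_N):\hat U\to\hat V$ be a $DC_0$ transition map, i.e. a homeomorphism such that the components of $F$ belong to $DC_0(\hat U)$ and those of $F^{-1}$ belong to $DC_0(\hat V)$. The pull-back of a signed Radon measure $\mu$ on $\hat V$ is $F^*(\mu)=(F^{-1})_\sharp\bigl(|\det dF^{-1}|\,\mu\bigr)$. **Corollary 3.6.** Let $h\in\mathcal{BV}(\hat V)$. Then $h\circ F\in BV_{loc}(\hat U)$, and for every $i\in\{1,\dots,N\}$ $$\frac{\partial}{\partial x_i}(h\circ F)=\sum_{s=1}^N\frac{\partial F_s}{\partial x_i}\,F^*\Bigl(\frac{\partial h}{\partial y_s}\Bigr)$$ as signed Radon measures on $\hat U$; in particular, the right-hand side is a signed Radon measure on $\hat U$. -/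

import Mathlib

open MeasureTheory Set
open scoped ENNReal

noncomputable section

namespace DCCalculus

/-- Euclidean space `ℝ^N`. -/
abbrev E (N : ℕ) : Type := EuclideanSpace ℝ (Fin N)

/-- The classical partial derivative `∂f/∂x_i` at `x`. At points where `f` is not differentiable
its value is arbitrary (here `0`). -/
def partialDeriv {N : ℕ} (i : Fin N) (f : E N → ℝ) (x : E N) : ℝ :=
  fderiv ℝ f x (EuclideanSpace.single i 1)

/-! ### Semiconcave and DC functions -/

/-- `f` is semiconcave on `Ω`: near every point of `Ω` it becomes concave after subtracting a
multiple of `‖y‖²`. -/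
def IsSemiconcaveOn {N : ℕ} (Ω : Set (E N)) (f : E N → ℝ) : Prop :=
  ∀ x ∈ Ω, ∃ r > 0, Metric.ball x r ⊆ Ω ∧
    ∃ C : ℝ, ConcaveOn ℝ (Metric.ball x r) (fun y => f y - C * ‖y‖ ^ 2)

/-- `f` is a DC function on `Ω`: locally a difference of two semiconcave functions. -/
def IsDCOn {N : ℕ} (Ω : Set (E N)) (f : E N → ℝ) : Prop :=
  ∀ x ∈ Ω, ∃ r > 0, Metric.ball x r ⊆ Ω ∧
    ∃ g₁ g₂ : E N → ℝ, IsSemiconcaveOn (Metric.ball x r) g₁ ∧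
      IsSemiconcaveOn (Metric.ball x r) g₂ ∧ ∀ y ∈ Metric.ball x r, f y = g₁ y - g₂ y

/-! ### Weakly continuous functions -/

/-- `S` is negligible for the Hausdorff measure `ℋ^{N-1}`. -/
def IsHausdorffNull {N : ℕ} (S : Set (E N)) : Prop :=
  Measure.hausdorffMeasure ((N : ℝ) - 1) S = 0

/-- `S` is the union of an increasing sequence of sets of finite `ℋ^{N-1}` measure. -/
def IsHausdorffSigmaFinite {N : ℕ} (S : Set (E N)) : Prop :=
  ∃ T : ℕ → Set (E N), Monotone T ∧
    (∀ n, Measure.hausdorffMeasure ((N : ℝ) - 1) (T n) < ∞) ∧ S = ⋃ n, T n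

/-- `f` restricted to `Ω \ S` is continuous, and it is locally bounded in `Ω`. -/
def IsContinuousOff {N : ℕ} (Ω S : Set (E N)) (f : E N → ℝ) : Prop :=
  ContinuousOn f (Ω \ S) ∧
    ∀ x ∈ Ω, ∃ r > 0, Metric.closedBall x r ⊆ Ω ∧
      ∃ M : ℝ, ∀ y ∈ Metric.ball x r \ S, |f y| ≤ M

/-- The class `C_w(Ω)`. -/
def MemCw {N : ℕ} (Ω : Set (E N)) (f : E N → ℝ) : Prop :=
  ∃ S : Set (E N), IsHausdorffSigmaFinite S ∧ IsContinuousOff Ω S f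

/-- The class `DC_0(Ω)`: DC functions all of whose first partial derivatives are continuous
and locally bounded off an `ℋ^{N-1}`-negligible set. -/
def MemDC0 {N : ℕ} (Ω : Set (E N)) (f : E N → ℝ) : Prop :=
  IsDCOn Ω f ∧ ∃ S : Set (E N), IsHausdorffNull S ∧
    ∀ i : Fin N, IsContinuousOff Ω S (partialDeriv i f)

/-- A homeomorphism `F` between the open sets `F.source` and `F.target` of `ℝ^N` is a `DC_0`
transition map if the components of both `F` and its inverse are of class `DC_0`.
A change of charts in a `DC_0` manifold is of this kind, since the inverse of a
change of charts is again a change of charts. -/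
def IsDC0Transition {N : ℕ} (F : OpenPartialHomeomorph (E N) (E N)) : Prop :=
  (∀ s : Fin N, MemDC0 F.source (fun x => F x s)) ∧
    ∀ s : Fin N, MemDC0 F.target (fun y => F.symm y s)

/-! ### Signed Radon measures -/

/-- A formal difference `pos - neg` of two positive Borel measures. It is a signed Radon measure
on an open set `Ω` when both are finite on the compact subsets of `Ω` (`IsRadonOn`), and it is
then regarded as the set function `eval` on the Borel sets relatively compact in `Ω`; two such
are the same signed Radon measure on `Ω` when they satisfy `EqOn`. -/
structure SignedPair (N : ℕ) where
  pos : Measure (E N)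
  neg : Measure (E N)

namespace SignedPair

variable {N : ℕ}

/-- Both parts are finite on compact subsets of `Ω`. -/
def IsRadonOn (Ω : Set (E N)) (μ : SignedPair N) : Prop :=
  ∀ K ⊆ Ω, IsCompact K → μ.pos K < ∞ ∧ μ.neg K < ∞

/-- The value `μ(B)`. -/
def eval (μ : SignedPair N) (B : Set (E N)) : ℝ :=
  (μ.pos B).toReal - (μ.neg B).toReal

/-- Equality as signed Radon measures on `Ω`: same value on every Borel set that is contained in
a compact subset of `Ω`. -/
def EqOn (Ω : Set (E N)) (μ ν : SignedPair N) : Prop :=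
  ∀ B : Set (E N), MeasurableSet B → (∃ K ⊆ Ω, IsCompact K ∧ B ⊆ K) → μ.eval B = ν.eval B

/-- The integral over `Ω` against `μ`. -/
def integral (Ω : Set (E N)) (μ : SignedPair N) (φ : E N → ℝ) : ℝ :=
  (∫ x in Ω, φ x ∂μ.pos) - ∫ x in Ω, φ x ∂μ.neg

/-- The finite sum `∑ s, μ s`. -/
def sum (μ : Fin N → SignedPair N) : SignedPair N where
  pos := ∑ s, (μ s).pos
  neg := ∑ s, (μ s).neg

/-- The product `k μ` of `μ` with a function `k`: with `k = k⁺ - k⁻`, it is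
`(k⁺ pos + k⁻ neg) - (k⁻ pos + k⁺ neg)`. -/
def mulFun (k : E N → ℝ) (μ : SignedPair N) : SignedPair N where
  pos := μ.pos.withDensity (fun x => ENNReal.ofReal (k x)) +
    μ.neg.withDensity (fun x => ENNReal.ofReal (-k x))
  neg := μ.pos.withDensity (fun x => ENNReal.ofReal (-k x)) +
    μ.neg.withDensity (fun x => ENNReal.ofReal (k x))

/-- The pull-back `F^*(m) = (F⁻¹)_♯ (|det dF⁻¹| m)` of a positive measure on `F.target`. -/
def pullbackMeasure (F : OpenPartialHomeomorph (E N) (E N)) (m : Measure (E N)) :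
    Measure (E N) :=
  ((m.restrict F.target).withDensity
    (fun y => ENNReal.ofReal |(fderiv ℝ F.symm y).det|)).map F.symm

/-- The pull-back `F^*(μ) = (F⁻¹)_♯ (|det dF⁻¹| μ)`. -/
def pullback (F : OpenPartialHomeomorph (E N) (E N)) (μ : SignedPair N) : SignedPair N where
  pos := pullbackMeasure F μ.pos
  neg := pullbackMeasure F μ.neg

end SignedPair

/-! ### Functions of locally bounded variation -/

/-- `φ ∈ Lip_c(Ω)`: Lipschitz with compact support in `Ω`. -/
def IsLipTest {N : ℕ} (Ω : Set (E N)) (φ : E N → ℝ) : Prop :=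
  (∃ L, LipschitzWith L φ) ∧ HasCompactSupport φ ∧ tsupport φ ⊆ Ω

/-- The signed Radon measure `μ` on `Ω` is the distributional derivative `∂f/∂x_i`. -/
def IsDistribDeriv {N : ℕ} (Ω : Set (E N)) (f : E N → ℝ) (i : Fin N) (μ : SignedPair N) : Prop :=
  μ.IsRadonOn Ω ∧ ∀ φ : E N → ℝ, IsLipTest Ω φ →
    ∫ x in Ω, f x * partialDeriv i φ x = -(μ.integral Ω φ)

/-- `f ∈ BV_loc(Ω)`: `f` is locally integrable in `Ω` and its distributional first derivatives
are signed Radon measures on `Ω`. -/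
def MemBVloc {N : ℕ} (Ω : Set (E N)) (f : E N → ℝ) : Prop :=
  LocallyIntegrableOn f Ω volume ∧ ∀ i : Fin N, ∃ μ : SignedPair N, IsDistribDeriv Ω f i μ

/-- The class of geometric `BV` functions on `Ω`: the intersection of `BV_loc(Ω)` and `C_w(Ω)`. -/
def MemGeomBV {N : ℕ} (Ω : Set (E N)) (f : E N → ℝ) : Prop :=
  MemBVloc Ω f ∧ MemCw Ω f

end DCCalculus

end

noncomputable section

namespace DCCalculus

open Filter Topology Metric
open scoped NNReal

variable {N : ℕ}

/-! ### Locally Lipschitz maps -/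

/-! Write G = F⁻¹ and let φ be a Lipschitz test function on the source. A change of variables gives
∫ (h ∘ F) ∂_iφ dx = ∫ h B dy with B = |det dG| (∂_iφ) ∘ G, while pairing φ with the claimed measure
gives ∑_s ∫ A_s d(∂h/∂y_s) with A_s = |det dG| (φ ∂_iF_s) ∘ G. The claim is therefore ∫ h B dy =
-∑_s ∫ A_s d(∂h/∂y_s). The bounded, compactly supported field A has weak divergence B
(`integral_pushDensity_divergence`): transported back to the source, this says only that ∫ ∂_i(φ ·
(ψ ∘ F)) dx = 0, and det dG is never differentiated.

For a Lipschitz field A the claim would be the definition of ∂h/∂y_s, so A is mollified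
(`setIntegral_mul_divergence`). The mollified divergence converges almost everywhere, which suffices
against h dy. The measures ∂h/∂y_s, however, may charge Lebesgue-null sets, so A has to converge off
a set that they do not see. The DC_0 hypotheses on F and G make A continuous off an ℋ^{N-1}-null set
(`IsDC0Transition.exists_null_continuousWithinAt`), and ∂h/∂y_s vanishes on compact ℋ^{N-1}-null
sets (`IsDistribDeriv.eval_eq_zero`): h is locally essentially bounded, and such a set has Lipschitz
cutoffs whose gradients have arbitrarily small L¹ norm.

DC functions are locally Lipschitz, which supplies Rademacher's theorem, the change of variables and
the preservation of null sets. Lipschitz test functions determine a signed Radon measure, which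
turns the tested identity into an equality of measures. -/

theorem IsSemiconcaveOn.locallyLipschitzOn {Ω : Set (E N)} {f : E N → ℝ}
    (hf : IsSemiconcaveOn Ω f) : LocallyLipschitzOn Ω f := by
  intro x hx
  obtain ⟨r, hr, -, C, hC⟩ := hf x hx
  have h1 : LocallyLipschitzOn (ball x r) (fun y => f y - C * ‖y‖ ^ 2) :=
    hC.locallyLipschitzOn isOpen_ball
  have h2 : LocallyLipschitzOn (ball x r) (fun y : E N => C * ‖y‖ ^ 2) := by
    have : ContDiff ℝ 1 (fun y : E N => C * ‖y‖ ^ 2) := contDiff_const.mul (contDiff_norm_sq ℝ)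
    exact this.locallyLipschitz.locallyLipschitzOn
  obtain ⟨K₁, t₁, ht₁, hK₁⟩ := h1 (mem_ball_self hr)
  obtain ⟨K₂, t₂, ht₂, hK₂⟩ := h2 (mem_ball_self hr)
  refine ⟨K₁ + K₂, t₁ ∩ t₂, ?_, ?_⟩
  · rw [isOpen_ball.nhdsWithin_eq (mem_ball_self hr)] at ht₁ ht₂
    exact mem_nhdsWithin_of_mem_nhds (inter_mem ht₁ ht₂)
  · have := (hK₁.mono inter_subset_left).add (hK₂.mono inter_subset_right)
    simpa using this

theorem IsDCOn.locallyLipschitzOn {Ω : Set (E N)} {f : E N → ℝ}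
    (hf : IsDCOn Ω f) : LocallyLipschitzOn Ω f := by
  intro x hx
  obtain ⟨r, hr, -, g₁, g₂, h₁, h₂, h⟩ := hf x hx
  obtain ⟨K₁, t₁, ht₁, hK₁⟩ := h₁.locallyLipschitzOn (mem_ball_self hr)
  obtain ⟨K₂, t₂, ht₂, hK₂⟩ := h₂.locallyLipschitzOn (mem_ball_self hr)
  rw [isOpen_ball.nhdsWithin_eq (mem_ball_self hr)] at ht₁ ht₂
  refine ⟨K₁ + K₂, t₁ ∩ t₂ ∩ ball x r,
    mem_nhdsWithin_of_mem_nhds (inter_mem (inter_mem ht₁ ht₂) (ball_mem_nhds x hr)), ?_⟩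
  have h3 := (hK₁.mono (inter_subset_left.trans inter_subset_left :
    t₁ ∩ t₂ ∩ ball x r ⊆ t₁)).sub (hK₂.mono (inter_subset_left.trans inter_subset_right))
  intro y hy z hz
  rw [h y hy.2, h z hz.2]
  exact h3 hy hz

theorem locallyLipschitzOn_of_components {Ω : Set (E N)} {F : E N → E N}
    (hF : ∀ s, LocallyLipschitzOn Ω (fun x => F x s)) : LocallyLipschitzOn Ω F := by
  intro x hx
  choose K t ht hK using fun s => hF s hx
  have h1 : LipschitzOnWith (Finset.univ.sup K) (fun x => WithLp.ofLp (F x)) (⋂ s, t s) := by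
    intro y hy z hz
    refine (edist_pi_le_iff.2 fun s => ?_)
    refine (hK s (mem_iInter.1 hy s) (mem_iInter.1 hz s)).trans ?_
    gcongr
    exact Finset.le_sup (Finset.mem_univ s)
  have h2 := (PiLp.lipschitzWith_toLp 2 (fun _ : Fin N => ℝ)).comp_lipschitzOnWith h1
  exact ⟨_, ⋂ s, t s, Filter.iInter_mem.2 ht, h2⟩

/-- The Lipschitz constant is only local, but by the Lindelöf property countably many of the
neighbourhoods cover `S`. -/
theorem hausdorffMeasure_image_eq_zero {d : ℝ} (hd : 0 ≤ d) {Ω S : Set (E N)} {F : E N → E N}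
    (hF : LocallyLipschitzOn Ω F) (hS : S ⊆ Ω) (h0 : Measure.hausdorffMeasure d S = 0) :
    Measure.hausdorffMeasure d (F '' S) = 0 := by
  have h1 : ∀ x ∈ S, ∃ K, ∃ t ∈ 𝓝[S] x, LipschitzOnWith K F t := fun x hx => hF.mono hS hx
  choose! K t ht hK using h1
  obtain ⟨c, hcS, hc, hcov⟩ := TopologicalSpace.countable_cover_nhdsWithin ht
  have : F '' S ⊆ ⋃ x ∈ c, F '' (t x ∩ S) := by
    rintro _ ⟨y, hy, rfl⟩
    obtain ⟨x, hx, hyx⟩ := mem_iUnion₂.1 (hcov hy)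
    exact mem_iUnion₂.2 ⟨x, hx, y, ⟨hyx, hy⟩, rfl⟩
  refine measure_mono_null this ((measure_biUnion_null_iff hc).2 ?_)
  intro x hx
  have := ((hK x (hcS hx)).mono inter_subset_left :
    LipschitzOnWith (K x) F (t x ∩ S)).hausdorffMeasure_image_le hd
  rw [measure_mono_null inter_subset_right h0, mul_zero] at this
  exact le_antisymm this bot_le

/-- ℋ^N is a Haar measure, so it has the same null sets as Lebesgue measure. -/
theorem volume_eq_zero_iff (S : Set (E N)) :
    volume S = 0 ↔ Measure.hausdorffMeasure (N : ℝ) S = 0 := by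
  have hfr : Module.finrank ℝ (E N) = N := finrank_euclideanSpace_fin
  have h1 : Measure.IsAddHaarMeasure (Measure.hausdorffMeasure (N : ℝ) : Measure (E N)) := by
    have := isAddHaarMeasure_hausdorffMeasure (E := E N)
    rwa [hfr] at this
  exact ⟨fun h => Measure.absolutelyContinuous_isAddHaarMeasure _ _ h,
    fun h => Measure.absolutelyContinuous_isAddHaarMeasure _ _ h⟩

theorem volume_image_eq_zero {Ω S : Set (E N)} {F : E N → E N}
    (hF : LocallyLipschitzOn Ω F) (hS : S ⊆ Ω) (h0 : volume S = 0) : volume (F '' S) = 0 := by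
  rw [volume_eq_zero_iff] at h0 ⊢
  exact hausdorffMeasure_image_eq_zero N.cast_nonneg hF hS h0

theorem IsHausdorffNull.volume_eq_zero {S : Set (E N)} (hS : IsHausdorffNull S) :
    volume S = 0 := by
  rw [volume_eq_zero_iff]
  exact le_antisymm ((Measure.hausdorffMeasure_mono (by linarith) S).trans hS.le) bot_le

theorem IsHausdorffSigmaFinite.volume_eq_zero {S : Set (E N)} (hS : IsHausdorffSigmaFinite S) :
    volume S = 0 := by
  obtain ⟨T, -, hT, rfl⟩ := hS
  rw [measure_iUnion_null_iff]
  intro n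
  rw [volume_eq_zero_iff]
  -- Finite measure in dimension N - 1 forces measure zero in dimension N.
  exact (Measure.hausdorffMeasure_zero_or_top (by linarith : (N : ℝ) - 1 < N) (T n)).resolve_right
    (hT n).ne

theorem volume_not_differentiableAt_eq_zero {Ω : Set (E N)} (hΩ : IsOpen Ω) {F : Type*}
    [NormedAddCommGroup F] [NormedSpace ℝ F] [FiniteDimensional ℝ F] {f : E N → F}
    (hf : LocallyLipschitzOn Ω f) :
    volume {x | x ∈ Ω ∧ ¬ DifferentiableAt ℝ f x} = 0 := by
  refine measure_null_of_locally_null _ fun x hx => ?_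
  obtain ⟨K, t, ht, hK⟩ := hf hx.1
  rw [hΩ.nhdsWithin_eq hx.1] at ht
  obtain ⟨u, hut, hu, hxu⟩ := _root_.mem_nhds_iff.1 ht
  have := (hK.mono hut).ae_differentiableWithinAt_of_mem (μ := volume)
  refine ⟨{y | ¬ (y ∈ u → DifferentiableWithinAt ℝ f u y)} ∩ {x | x ∈ Ω ∧ ¬ DifferentiableAt ℝ f x},
    ?_, measure_mono_null inter_subset_left this⟩
  filter_upwards [mem_nhdsWithin_of_mem_nhds (hu.mem_nhds hxu), self_mem_nhdsWithin] with y hy hy2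
  refine ⟨fun h => hy2.2 ?_, hy2⟩
  exact (h hy).differentiableAt (hu.mem_nhds hy)

theorem measurable_partialDeriv (i : Fin N) (f : E N → ℝ) : Measurable (partialDeriv i f) :=
  measurable_fderiv_apply_const ℝ f _

theorem exists_bound_norm_fderiv {Ω K : Set (E N)} (hΩ : IsOpen Ω) {F : Type*}
    [NormedAddCommGroup F] [NormedSpace ℝ F] {f : E N → F}
    (hf : LocallyLipschitzOn Ω f) (hK : IsCompact K) (hKΩ : K ⊆ Ω) :
    ∃ C : ℝ, 0 ≤ C ∧ ∀ x ∈ K, ‖fderiv ℝ f x‖ ≤ C := by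
  -- The derivative at a point of `K` is bounded by a Lipschitz constant on a neighbourhood of that
  -- point, hence the larger compact set.
  obtain ⟨K', hK', h1, h2⟩ := exists_compact_between hK hΩ hKΩ
  obtain ⟨C, hC⟩ := (hf.mono h2).exists_lipschitzOnWith_of_compact hK'
  exact ⟨C, C.2, fun x hx => norm_fderiv_le_of_lipschitzOn ℝ
    (mem_interior_iff_mem_nhds.1 (h1 hx)) hC⟩

theorem abs_partialDeriv_le (i : Fin N) (f : E N → ℝ) (x : E N) :
    |partialDeriv i f x| ≤ ‖fderiv ℝ f x‖ := by
  have := (fderiv ℝ f x).le_opNorm (EuclideanSpace.single i 1)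
  simpa [partialDeriv] using this

theorem exists_bound_partialDeriv {Ω K : Set (E N)} (hΩ : IsOpen Ω) {f : E N → ℝ}
    (hf : LocallyLipschitzOn Ω f) (hK : IsCompact K) (hKΩ : K ⊆ Ω) (i : Fin N) :
    ∃ C : ℝ, 0 ≤ C ∧ ∀ x ∈ K, |partialDeriv i f x| ≤ C := by
  obtain ⟨C, h0, hC⟩ := exists_bound_norm_fderiv hΩ hf hK hKΩ
  exact ⟨C, h0, fun x hx => (abs_partialDeriv_le i f x).trans (hC x hx)⟩

theorem partialDeriv_component {G : E N → E N} {y : E N} (hG : DifferentiableAt ℝ G y)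
    (i s : Fin N) :
    partialDeriv i (fun x => G x s) y = fderiv ℝ G y (EuclideanSpace.single i 1) s := by
  have h1 : HasFDerivAt (fun x => G x s)
      ((EuclideanSpace.proj s : E N →L[ℝ] ℝ).comp (fderiv ℝ G y)) y :=
    (EuclideanSpace.proj s : E N →L[ℝ] ℝ).hasFDerivAt.comp y hG.hasFDerivAt
  rw [partialDeriv, h1.fderiv]
  rfl

/-- Also at points where `G` is not differentiable: then some component is not differentiable
either, and both sides vanish. -/
theorem det_fderiv_eq [NeZero N] (G : E N → E N) (y : E N) :
    (fderiv ℝ G y).det = (Matrix.of fun s i => partialDeriv i (fun x => G x s) y).det := by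
  by_cases hG : DifferentiableAt ℝ G y
  · rw [ContinuousLinearMap.det, ← LinearMap.det_toMatrix (EuclideanSpace.basisFun (Fin N) ℝ).toBasis]
    congr 1
    ext s i
    rw [Matrix.of_apply, partialDeriv_component hG, LinearMap.toMatrix_apply]
    simp
  · have h1 : ∃ s, ¬ DifferentiableAt ℝ (fun x => G x s) y := by
      by_contra! h
      exact hG (differentiableAt_euclidean.2 h)
    obtain ⟨s, hs⟩ := h1
    rw [Matrix.det_eq_zero_of_row_eq_zero s, fderiv_zero_of_not_differentiableAt hG]
    -- The zero map has determinant zero only in positive dimension.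
    · have : Nontrivial (E N) := by
        refine ⟨0, EuclideanSpace.single 0 1, fun h => ?_⟩
        have := congrArg (fun v : E N => v 0) h
        simp at this
      simp [ContinuousLinearMap.det]
    · intro j
      simp [partialDeriv, fderiv_zero_of_not_differentiableAt hs]

theorem measurable_det_fderiv (G : E N → E N) : Measurable fun y => (fderiv ℝ G y).det :=
  ContinuousLinearMap.continuous_det.measurable.comp (measurable_fderiv ℝ G)

theorem exists_bound_det_fderiv {Ω K : Set (E N)} (hΩ : IsOpen Ω) {G : E N → E N}
    (hf : LocallyLipschitzOn Ω G) (hK : IsCompact K) (hKΩ : K ⊆ Ω) :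
    ∃ C : ℝ, 0 ≤ C ∧ ∀ x ∈ K, |(fderiv ℝ G x).det| ≤ C := by
  obtain ⟨C, h0, hC⟩ := exists_bound_norm_fderiv hΩ hf hK hKΩ
  obtain ⟨D, hD⟩ := (isCompact_closedBall (0 : E N →L[ℝ] E N) C).exists_bound_of_continuousOn
    ContinuousLinearMap.continuous_det.continuousOn
  refine ⟨max D 0, le_max_right _ _, fun x hx => le_trans ?_ (le_max_left _ _)⟩
  exact hD _ (by simpa using hC x hx)

/-- The determinant is a polynomial in the partial derivatives at every point, including those of
non-differentiability, so no further exceptional set appears. -/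
theorem continuousOn_det_fderiv [NeZero N] {Ω S : Set (E N)} {G : E N → E N}
    (hG : ∀ s i, ContinuousOn (partialDeriv i fun x => G x s) (Ω \ S)) :
    ContinuousOn (fun y => (fderiv ℝ G y).det) (Ω \ S) := by
  simp_rw [det_fderiv_eq]
  intro y hy
  refine ContinuousWithinAt.congr_of_eventuallyEq ?_ EventuallyEq.rfl rfl
  exact (Continuous.matrix_det continuous_id).continuousAt.comp_continuousWithinAt
    (tendsto_pi_nhds.2 fun s => tendsto_pi_nhds.2 fun i => hG s i y hy)

/-! ### Signed Radon measures tested against cutoff functions -/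

theorem setIntegral_eq_of_support_subset {Ω K : Set (E N)} (hΩ : IsOpen Ω) (hKΩ : K ⊆ Ω)
    {φ : E N → ℝ} (hφ : ∀ x ∉ K, φ x = 0) (m : Measure (E N)) :
    ∫ x in Ω, φ x ∂m = ∫ x in K, φ x ∂m :=
  (setIntegral_eq_of_subset_of_forall_sdiff_eq_zero hΩ.measurableSet hKΩ
    fun x hx => hφ x hx.2)

/-- The cutoffs tend pointwise to the indicator of `K`, since a compact set is the intersection of
its closed thickenings. They are eventually supported in one compact thickening of finite mass,
where the constant 1 dominates. -/
theorem tendsto_setIntegral_cutoff {Ω K : Set (E N)} (hΩ : IsOpen Ω) (hK : IsCompact K)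
    (hKΩ : K ⊆ Ω) {m : Measure (E N)} (hm : ∀ K ⊆ Ω, IsCompact K → m K < ∞)
    {φ : ℕ → E N → ℝ} {δ : ℕ → ℝ} (hδ : Tendsto δ atTop (𝓝 0)) (hφ : ∀ n, Continuous (φ n))
    (h1 : ∀ n, ∀ x ∈ K, φ n x = 1) (h01 : ∀ n x, φ n x ∈ Icc (0 : ℝ) 1)
    (h0 : ∀ n, ∀ x ∉ cthickening (δ n) K, φ n x = 0) :
    Tendsto (fun n => ∫ x in Ω, φ n x ∂m) atTop (𝓝 (m K).toReal) := by
  obtain ⟨δ₀, hδ₀, hsub⟩ := hK.exists_cthickening_subset_open hΩ hKΩ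
  have hK' : IsCompact (cthickening δ₀ K) := hK.cthickening
  have : IsFiniteMeasure (m.restrict (cthickening δ₀ K)) := ⟨by simpa using hm _ hsub hK'⟩
  have hev : ∀ᶠ n in atTop, δ n ≤ δ₀ := (hδ.eventually (gt_mem_nhds hδ₀)).mono fun _ h => h.le
  have heq : ∀ᶠ n in atTop,
      ∫ x in cthickening δ₀ K, φ n x ∂m = ∫ x in Ω, φ n x ∂m := by
    filter_upwards [hev] with n hn
    exact (setIntegral_eq_of_support_subset hΩ hsub
      (fun x hx => h0 n x fun h => hx (cthickening_mono hn K h)) m).symm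
  refine Tendsto.congr' heq ?_
  have hlim : ∫ x in cthickening δ₀ K, K.indicator (fun _ => (1 : ℝ)) x ∂m = (m K).toReal := by
    rw [integral_indicator hK.measurableSet, Measure.restrict_restrict hK.measurableSet,
      inter_eq_self_of_subset_left (self_subset_cthickening K)]
    simp [Measure.real]
  rw [← hlim]
  refine tendsto_integral_of_dominated_convergence (fun _ => 1)
    (fun n => (hφ n).aestronglyMeasurable) (integrable_const _) (fun n => ?_) ?_
  · exact Eventually.of_forall fun x => by
      rw [Real.norm_eq_abs, abs_of_nonneg (h01 n x).1]; exact (h01 n x).2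
  · refine Eventually.of_forall fun x => ?_
    by_cases hx : x ∈ K
    · simp [h1 _ x hx, hx]
    · have : ∃ ε > 0, x ∉ cthickening ε K := by
        by_contra! h
        apply hx
        rw [← hK.isClosed.closure_eq, closure_eq_iInter_cthickening]
        exact mem_iInter₂.2 h
      obtain ⟨ε, hε, hxε⟩ := this
      rw [indicator_of_notMem hx]
      refine tendsto_const_nhds.congr' ?_
      filter_upwards [hδ.eventually (gt_mem_nhds hε)] with n hn
      exact (h0 n x fun h => hxε (cthickening_mono hn.le K h)).symm

theorem SignedPair.IsRadonOn.tendsto_integral_cutoff {Ω K : Set (E N)} (hΩ : IsOpen Ω)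
    (hK : IsCompact K) (hKΩ : K ⊆ Ω) {μ : SignedPair N} (hμ : μ.IsRadonOn Ω)
    {φ : ℕ → E N → ℝ} {δ : ℕ → ℝ} (hδ : Tendsto δ atTop (𝓝 0)) (hφ : ∀ n, Continuous (φ n))
    (h1 : ∀ n, ∀ x ∈ K, φ n x = 1) (h01 : ∀ n x, φ n x ∈ Icc (0 : ℝ) 1)
    (h0 : ∀ n, ∀ x ∉ cthickening (δ n) K, φ n x = 0) :
    Tendsto (fun n => μ.integral Ω (φ n)) atTop (𝓝 (μ.eval K)) :=
  (tendsto_setIntegral_cutoff hΩ hK hKΩ (fun K h h' => (hμ K h h').1) hδ hφ h1 h01 h0).sub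
    (tendsto_setIntegral_cutoff hΩ hK hKΩ (fun K h h' => (hμ K h h').2) hδ hφ h1 h01 h0)

/-- Inner regularity of finite Borel measures. -/
theorem restrict_eq_of_forall_isCompact {a b : Measure (E N)} [IsFiniteMeasure a]
    [IsFiniteMeasure b] {Z : Set (E N)} (hZ : MeasurableSet Z)
    (h : ∀ C ⊆ Z, IsCompact C → a C = b C) : a.restrict Z = b.restrict Z := by
  ext B hB
  rw [Measure.restrict_apply hB, Measure.restrict_apply hB,
    (hB.inter hZ).measure_eq_iSup_isCompact_of_ne_top (measure_ne_top a _),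
    (hB.inter hZ).measure_eq_iSup_isCompact_of_ne_top (measure_ne_top b _)]
  refine iSup_congr fun C => iSup_congr fun hC => iSup_congr fun hC' => ?_
  exact h C (hC.trans inter_subset_right) hC'

theorem SignedPair.eqOn_of_forall_isCompact {Ω : Set (E N)} {μ ν : SignedPair N}
    (hμ : μ.IsRadonOn Ω) (hν : ν.IsRadonOn Ω)
    (h : ∀ K ⊆ Ω, IsCompact K → μ.eval K = ν.eval K) : μ.EqOn Ω ν := by
  rintro B hB ⟨K, hKΩ, hK, hBK⟩
  have hfin : ∀ C ⊆ K, μ.pos C ≠ ∞ ∧ μ.neg C ≠ ∞ ∧ ν.pos C ≠ ∞ ∧ ν.neg C ≠ ∞ := fun C hC =>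
    ⟨measure_ne_top_of_subset hC (hμ K hKΩ hK).1.ne, measure_ne_top_of_subset hC (hμ K hKΩ hK).2.ne,
      measure_ne_top_of_subset hC (hν K hKΩ hK).1.ne, measure_ne_top_of_subset hC (hν K hKΩ hK).2.ne⟩
  -- Moving the negative parts across turns an equality of differences into one of positive
  -- measures, to which inner regularity applies.
  have key : ∀ C ⊆ K, (μ.pos + ν.neg) C = (ν.pos + μ.neg) C ↔ μ.eval C = ν.eval C := by
    intro C hC
    obtain ⟨h1, h2, h3, h4⟩ := hfin C hC
    rw [Measure.add_apply, Measure.add_apply, ← ENNReal.toReal_eq_toReal_iff'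
      (ENNReal.add_ne_top.2 ⟨h1, h4⟩) (ENNReal.add_ne_top.2 ⟨h3, h2⟩), ENNReal.toReal_add h1 h4,
      ENNReal.toReal_add h3 h2, SignedPair.eval, SignedPair.eval]
    constructor <;> intro h <;> linarith
  obtain ⟨h1, h2, h3, h4⟩ := hfin K subset_rfl
  have : IsFiniteMeasure ((μ.pos + ν.neg).restrict K) :=
    ⟨by simpa using ⟨h1.lt_top, h4.lt_top⟩⟩
  have : IsFiniteMeasure ((ν.pos + μ.neg).restrict K) :=
    ⟨by simpa using ⟨h3.lt_top, h2.lt_top⟩⟩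
  have := restrict_eq_of_forall_isCompact (a := (μ.pos + ν.neg).restrict K)
    (b := (ν.pos + μ.neg).restrict K) hK.measurableSet fun C hC hC' => by
      rw [Measure.restrict_apply hC'.measurableSet, Measure.restrict_apply hC'.measurableSet,
        inter_eq_self_of_subset_left hC]
      exact (key C hC).2 (h C (hC.trans hKΩ) hC')
  have h5 := congrArg (fun m => m B) this
  simp only [Measure.restrict_restrict hK.measurableSet, inter_self,
    Measure.restrict_apply hB, inter_eq_self_of_subset_left hBK] at h5
  exact (key B hBK).1 h5

/-- The two parts need not be mutually singular, so each may charge a set on which their difference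
vanishes; what survives is that they coincide there. -/
theorem SignedPair.restrict_pos_eq_restrict_neg {Ω : Set (E N)} {μ : SignedPair N}
    (hμ : μ.IsRadonOn Ω) {K Z : Set (E N)} (hK : IsCompact K) (hKΩ : K ⊆ Ω)
    (hZ : MeasurableSet Z) (h : ∀ C ⊆ K ∩ Z, IsCompact C → μ.eval C = 0) :
    μ.pos.restrict (K ∩ Z) = μ.neg.restrict (K ∩ Z) := by
  have : IsFiniteMeasure (μ.pos.restrict K) := ⟨by simpa using (hμ K hKΩ hK).1⟩
  have : IsFiniteMeasure (μ.neg.restrict K) := ⟨by simpa using (hμ K hKΩ hK).2⟩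
  have := restrict_eq_of_forall_isCompact (a := μ.pos.restrict K)
    (b := μ.neg.restrict K) (hK.measurableSet.inter hZ) fun C hC hC' => by
      have hCK := hC.trans inter_subset_left
      rw [Measure.restrict_apply hC'.measurableSet, Measure.restrict_apply hC'.measurableSet,
        inter_eq_self_of_subset_left hCK]
      have := h C hC hC'
      rw [SignedPair.eval, sub_eq_zero] at this
      exact (ENNReal.toReal_eq_toReal_iff' (measure_ne_top_of_subset hCK (hμ K hKΩ hK).1.ne)
        (measure_ne_top_of_subset hCK (hμ K hKΩ hK).2.ne)).1 this
  simpa only [Measure.restrict_restrict (hK.measurableSet.inter hZ),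
    inter_eq_self_of_subset_left (inter_subset_left : K ∩ Z ⊆ K)] using this

theorem isLipTest_of_cutoff {Ω K : Set (E N)} {δ : ℝ} (hK : IsCompact K)
    (hsub : cthickening δ K ⊆ Ω) {φ : E N → ℝ} {L : ℝ≥0} (hφ : LipschitzWith L φ)
    (h0 : ∀ x ∉ cthickening δ K, φ x = 0) : IsLipTest Ω φ := by
  have : tsupport φ ⊆ cthickening δ K :=
    closure_minimal (fun x hx => by_contra fun h => hx (h0 x h)) isClosed_cthickening
  exact ⟨⟨L, hφ⟩, hK.cthickening.of_isClosed_subset (isClosed_tsupport φ) this, this.trans hsub⟩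

/-- Thickened indicators of a compact set are Lipschitz tests whose integrals converge to its
measure, and the values on compact sets determine the rest. -/
theorem SignedPair.eqOn_of_forall_integral_eq {Ω : Set (E N)} (hΩ : IsOpen Ω) {μ ν : SignedPair N}
    (hμ : μ.IsRadonOn Ω) (hν : ν.IsRadonOn Ω)
    (h : ∀ φ, IsLipTest Ω φ → μ.integral Ω φ = ν.integral Ω φ) : μ.EqOn Ω ν := by
  refine eqOn_of_forall_isCompact hμ hν fun K hKΩ hK => ?_
  obtain ⟨δ₀, hδ₀, hsub⟩ := hK.exists_cthickening_subset_open hΩ hKΩ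
  have hpos : ∀ n : ℕ, 0 < δ₀ / (n + 1) := fun n => by positivity
  set φ : ℕ → E N → ℝ := fun n x => (thickenedIndicator (hpos n) K x : ℝ)
  have hδ : Tendsto (fun n : ℕ => δ₀ / ((n : ℝ) + 1)) atTop (𝓝 0) :=
    tendsto_const_div_atTop_nhds_zero_nat δ₀ |>.comp (tendsto_add_atTop_nat 1) |>.congr
      fun n => by simp
  have hlip : ∀ n : ℕ, LipschitzWith (δ₀ / (n + 1)).toNNReal⁻¹ (φ n) := fun n =>
    lipschitzWith_thickenedIndicator (hpos n) K
  have h0 : ∀ n : ℕ, ∀ x ∉ cthickening (δ₀ / (n + 1)) K, φ n x = 0 := fun n x hx => by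
    exact NNReal.coe_eq_zero.2 (thickenedIndicator_zero (hpos n) K
      fun h => hx (thickening_subset_cthickening _ _ h))
  have h1 : ∀ n, ∀ x ∈ K, φ n x = 1 := fun n x hx => by
    exact NNReal.coe_eq_one.2 (thickenedIndicator_one (hpos n) K hx)
  have h01 : ∀ n x, φ n x ∈ Icc (0 : ℝ) 1 := fun n x =>
    ⟨NNReal.coe_nonneg _, NNReal.coe_le_one.2 (thickenedIndicator_le_one (hpos n) K x)⟩
  have hle : ∀ n : ℕ, δ₀ / ((n : ℝ) + 1) ≤ δ₀ := fun n =>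
    div_le_self hδ₀.le (by linarith [(n.cast_nonneg : (0 : ℝ) ≤ n)])
  refine tendsto_nhds_unique (hμ.tendsto_integral_cutoff hΩ hK hKΩ hδ
    (fun n => (hlip n).continuous) h1 h01 h0) ?_
  simp_rw [fun n => h (φ n) (isLipTest_of_cutoff hK ((cthickening_mono (hle n) K).trans hsub)
    (hlip n) (h0 n))]
  exact hν.tendsto_integral_cutoff hΩ hK hKΩ hδ
    (fun n => (hlip n).continuous) h1 h01 h0

/-! ### Distributional derivatives of bounded functions vanish on `ℋ^{N-1}`-null sets -/

/-- The definition of ℋ^{N-1} gives countable covers by small sets with small sum of diam^{N-1}.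
Each set meeting `K` is replaced by an open ball centred in `K` of slightly larger radius than its
diameter, and compactness leaves finitely many. -/
theorem IsHausdorffNull.exists_finite_cover [NeZero N] {K : Set (E N)} (hK : IsCompact K)
    (h0 : IsHausdorffNull K) {ε δ : ℝ} (hε : 0 < ε) (hδ : 0 < δ) :
    ∃ (ι : Type) (J : Finset ι) (x : ι → E N) (r : ι → ℝ), (∀ j, x j ∈ K) ∧
      (∀ j, 0 < r j ∧ r j ≤ δ) ∧ K ⊆ ⋃ j ∈ J, ball (x j) (r j) ∧ ∑ j ∈ J, r j ^ (N - 1) ≤ ε := by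
  have hN : 1 ≤ N := NeZero.one_le
  rcases hN.eq_or_lt with rfl | hN2
  -- For N = 1 the exponent N - 1 is zero and cannot be inverted below, but an ℋ^0-null set is
  -- empty.
  · have hKe : K = ∅ := by
      by_contra h
      have := Measure.one_le_hausdorffMeasure_zero_of_nonempty (nonempty_iff_ne_empty.2 h)
      have h0' : Measure.hausdorffMeasure (0 : ℝ) K = 0 := by simpa [IsHausdorffNull] using h0
      rw [h0'] at this
      exact absurd this (by simp)
    exact ⟨Empty, ∅, Empty.elim, Empty.elim, fun j => j.elim, fun j => j.elim, by simp [hKe],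
      by simpa using hε.le⟩
  set d : ℝ := (N : ℝ) - 1 with hd
  have hdN : d = ((N - 1 : ℕ) : ℝ) := by rw [hd]; push_cast [hN]; ring
  have hd0 : 0 < d := by
    have : (1 : ℝ) < N := by exact_mod_cast hN2
    linarith
  have hδ' : (0 : ℝ≥0∞) < ENNReal.ofReal (δ / 2) := by simpa using hδ
  have hε' : (0 : ℝ≥0∞) < ENNReal.ofReal (ε / 2) := by simpa using hε
  have h1 : ⨅ (t : ℕ → Set (E N)) (_ : K ⊆ ⋃ n, t n)
      (_ : ∀ n, ediam (t n) ≤ ENNReal.ofReal (δ / 2)),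
        ∑' n, ⨆ _ : (t n).Nonempty, ediam (t n) ^ d < ENNReal.ofReal (ε / 2) := by
    refine lt_of_le_of_lt ?_ hε'
    have h2 : Measure.hausdorffMeasure d K ≤ 0 := h0.le
    rw [Measure.hausdorffMeasure_apply] at h2
    exact (le_iSup₂ (f := fun (r : ℝ≥0∞) (_ : 0 < r) =>
        ⨅ (t : ℕ → Set (E N)) (_ : K ⊆ ⋃ n, t n) (_ : ∀ n, ediam (t n) ≤ r),
          ∑' n, ⨆ _ : (t n).Nonempty, ediam (t n) ^ d) _ hδ').trans h2
  simp only [iInf_lt_iff] at h1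
  obtain ⟨t, htK, htd, hts⟩ := h1
  obtain ⟨η, hη, hηs⟩ := ENNReal.exists_pos_sum_of_countable' hε'.ne' ℕ
  let ι : Type := {n : ℕ // (t n ∩ K).Nonempty}
  -- The summable excess `η` makes the radius positive and strictly larger than the diameter, even
  -- for a single point; the sets have diameter at most δ / 2, so capping at δ keeps the inequality
  -- strict.
  let R : ι → ℝ≥0∞ := fun n => min (ENNReal.ofReal δ) ((ediam (t n) ^ d + η n) ^ (1 / d))
  choose x hx using fun n : ι => n.2
  have hlt : ∀ n : ι, ediam (t n) < R n := fun n => by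
    refine lt_min ((htd n).trans_lt ?_) ?_
    · exact (ENNReal.ofReal_lt_ofReal_iff hδ).2 (by linarith)
    · have hne : ediam (t n) ^ d ≠ ∞ :=
        ENNReal.rpow_ne_top_of_nonneg hd0.le ((htd n).trans_lt ENNReal.ofReal_lt_top).ne
      have h3 : ediam (t n) ^ d < ediam (t n) ^ d + η n := ENNReal.lt_add_right hne (hη n).ne'
      calc ediam (t n) = (ediam (t n) ^ d) ^ (1 / d) := by
            rw [← ENNReal.rpow_mul, mul_one_div_cancel hd0.ne', ENNReal.rpow_one]
        _ < _ := ENNReal.rpow_lt_rpow h3 (by positivity)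
  have hRtop : ∀ n : ι, R n ≠ ∞ := fun n => ((min_le_left _ _).trans_lt ENNReal.ofReal_lt_top).ne
  have hRd : ∀ n : ι, R n ^ d ≤ ediam (t n) ^ d + η n := fun n => by
    calc R n ^ d ≤ ((ediam (t n) ^ d + η n) ^ (1 / d)) ^ d :=
          ENNReal.rpow_le_rpow (min_le_right _ _) hd0.le
      _ = _ := by rw [← ENNReal.rpow_mul, one_div_mul_cancel hd0.ne', ENNReal.rpow_one]
  have hcov : K ⊆ ⋃ n : ι, ball (x n) (R n).toReal := by
    intro y hy
    obtain ⟨n, hn⟩ := mem_iUnion.1 (htK hy)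
    refine mem_iUnion.2 ⟨⟨n, y, hn, hy⟩, ?_⟩
    set m : ι := ⟨n, y, hn, hy⟩
    have : edist y (x m) < R m := (edist_le_ediam_of_mem hn (hx m).1).trans_lt (hlt m)
    rw [mem_ball, dist_edist]
    exact (ENNReal.toReal_lt_toReal (edist_ne_top _ _) (hRtop m)).2 this
  obtain ⟨J, hJ⟩ := hK.elim_finite_subcover _ (fun n => isOpen_ball) hcov
  refine ⟨ι, J, x, fun n => (R n).toReal, fun j => (hx j).2, fun j => ⟨?_, ?_⟩, hJ, ?_⟩
  · exact ENNReal.toReal_pos (bot_le.trans_lt (hlt j)).ne' (hRtop j)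
  · exact ENNReal.toReal_le_of_le_ofReal hδ.le (min_le_left _ _)
  · have h5 : ∑ j ∈ J, R j ^ d ≤ ENNReal.ofReal ε := by
      calc ∑ j ∈ J, R j ^ d ≤ ∑ j ∈ J, (ediam (t j) ^ d + η j) := Finset.sum_le_sum fun j _ => hRd j
        _ ≤ ∑' j : ι, (ediam (t j) ^ d + η j) := ENNReal.sum_le_tsum _
        _ ≤ ∑' n : ℕ, ((⨆ _ : (t n).Nonempty, ediam (t n) ^ d) + η n) := by
          refine le_trans (ENNReal.tsum_le_tsum fun j => ?_) (ENNReal.tsum_comp_le_tsum_of_injective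
            (f := fun j : ι => (j : ℕ)) Subtype.val_injective
            (fun n : ℕ => (⨆ _ : (t n).Nonempty, ediam (t n) ^ d) + η n))
          gcongr
          exact le_iSup (fun _ : (t j).Nonempty => ediam (t j) ^ d) (j.2.mono inter_subset_left)
        _ ≤ ENNReal.ofReal (ε / 2) + ENNReal.ofReal (ε / 2) := by
          rw [ENNReal.tsum_add]
          exact add_le_add hts.le hηs.le
        _ = ENNReal.ofReal ε := by
          rw [← ENNReal.ofReal_add (by positivity) (by positivity), add_halves]
    have h6 : ∑ j ∈ J, (R j).toReal ^ (N - 1) = (∑ j ∈ J, R j ^ d).toReal := by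
      rw [ENNReal.toReal_sum fun j _ => ENNReal.rpow_ne_top_of_nonneg hd0.le (hRtop j)]
      refine Finset.sum_congr rfl fun j _ => ?_
      rw [← ENNReal.toReal_rpow, hdN, Real.rpow_natCast]
    rw [h6]
    exact ENNReal.toReal_le_of_le_ofReal hε.le h5

/-- The Lipschitz cutoff equal to `1` on `ball x r` and to `0` off `ball x (2 * r)`. -/
def tent (x : E N) (r : ℝ) (y : E N) : ℝ := max 0 (min 1 (2 - dist y x / r))

theorem tent_nonneg (x : E N) (r : ℝ) (y : E N) : 0 ≤ tent x r y := le_max_left _ _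

theorem tent_eq_one {x : E N} {r : ℝ} (hr : 0 < r) {y : E N} (hy : y ∈ ball x r) :
    tent x r y = 1 := by
  have : dist y x / r ≤ 1 := (div_le_one hr).2 (mem_ball.1 hy).le
  rw [tent, min_eq_left (by linarith), max_eq_right zero_le_one]

theorem tent_eq_zero {x : E N} {r : ℝ} (hr : 0 < r) {y : E N} (hy : y ∉ closedBall x (2 * r)) :
    tent x r y = 0 := by
  have : 2 ≤ dist y x / r := (le_div_iff₀ hr).2 (not_le.1 hy).le
  rw [tent, max_eq_left ((min_le_right _ _).trans (by linarith))]

theorem lipschitzWith_tent {x : E N} {r : ℝ} (hr : 0 < r) :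
    LipschitzWith r⁻¹.toNNReal (tent x r) := by
  have h : LipschitzWith r⁻¹.toNNReal (fun y : E N => 2 - dist y x / r) := by
    refine LipschitzWith.of_dist_le_mul fun y z => ?_
    rw [Real.coe_toNNReal _ (by positivity), Real.dist_eq,
      show 2 - dist y x / r - (2 - dist z x / r) = r⁻¹ * (dist z x - dist y x) by ring,
      abs_mul, abs_of_pos (inv_pos.2 hr), dist_comm y z]
    gcongr
    exact abs_dist_sub_le _ _ _
  exact (h.const_min 1).const_max 0

theorem abs_tent_sub_le {x : E N} {r : ℝ} (hr : 0 < r) (y z : E N) :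
    |tent x r z - tent x r y| ≤ r⁻¹ * ‖z - y‖ := by
  have := (lipschitzWith_tent (x := x) hr).dist_le_mul z y
  rwa [Real.coe_toNNReal _ (by positivity), Real.dist_eq, dist_eq_norm] at this

/-- A Lipschitz cutoff equal to `1` on a finite union of balls. -/
def ballsCutoff {ι : Type} (J : Finset ι) (x : ι → E N) (r : ι → ℝ) (y : E N) : ℝ :=
  min 1 (∑ j ∈ J, tent (x j) (r j) y)

section ballsCutoff

variable {ι : Type} {J : Finset ι} {x : ι → E N} {r : ι → ℝ}

theorem ballsCutoff_mem_Icc (y : E N) : ballsCutoff J x r y ∈ Icc (0 : ℝ) 1 :=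
  ⟨le_min zero_le_one (Finset.sum_nonneg fun _ _ => tent_nonneg _ _ _), min_le_left _ _⟩

theorem ballsCutoff_eq_one (hr : ∀ j, 0 < r j) {y : E N} (hy : y ∈ ⋃ j ∈ J, ball (x j) (r j)) :
    ballsCutoff J x r y = 1 := by
  obtain ⟨j, hj, hyj⟩ := mem_iUnion₂.1 hy
  refine min_eq_left ?_
  rw [← tent_eq_one (hr j) hyj]
  exact Finset.single_le_sum (f := fun j => tent (x j) (r j) y) (fun _ _ => tent_nonneg _ _ _) hj

theorem ballsCutoff_eq_zero (hr : ∀ j, 0 < r j) {y : E N}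
    (hy : ∀ j ∈ J, y ∉ closedBall (x j) (2 * r j)) : ballsCutoff J x r y = 0 := by
  rw [ballsCutoff, Finset.sum_eq_zero fun j hj => tent_eq_zero (hr j) (hy j hj)]
  simp

theorem abs_ballsCutoff_sub_le (y z : E N) :
    |ballsCutoff J x r z - ballsCutoff J x r y| ≤
      ∑ j ∈ J, |tent (x j) (r j) z - tent (x j) (r j) y| := by
  refine le_trans ?_ (Finset.abs_sum_le_sum_abs _ _)
  rw [Finset.sum_sub_distrib]
  have := (LipschitzWith.id (α := ℝ)).const_min 1
  simpa [Real.dist_eq, ballsCutoff] using this.dist_le_mul (∑ j ∈ J, tent (x j) (r j) z)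
    (∑ j ∈ J, tent (x j) (r j) y)

theorem exists_lipschitzWith_ballsCutoff (hr : ∀ j, 0 < r j) :
    ∃ L, LipschitzWith L (ballsCutoff J x r) := by
  refine ⟨(∑ j ∈ J, (r j)⁻¹).toNNReal, LipschitzWith.of_dist_le_mul fun y z => ?_⟩
  rw [Real.coe_toNNReal _ (Finset.sum_nonneg fun j _ => (inv_pos.2 (hr j)).le), Real.dist_eq,
    dist_eq_norm, Finset.sum_mul]
  exact (abs_ballsCutoff_sub_le _ _).trans (Finset.sum_le_sum fun j _ => abs_tent_sub_le (hr j) _ _)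

/-- The bound comes from the pointwise Lipschitz rate at `y`, so no differentiability is needed.
Tents whose closed double ball misses `y` vanish near `y` and contribute nothing. -/
theorem norm_fderiv_ballsCutoff_le (hr : ∀ j, 0 < r j) (y : E N) :
    ‖fderiv ℝ (ballsCutoff J x r) y‖ ≤
      ∑ j ∈ J, (closedBall (x j) (2 * r j)).indicator (fun _ => (r j)⁻¹) y := by
  have hnn : ∀ j, 0 ≤ (closedBall (x j) (2 * r j)).indicator (fun _ => (r j)⁻¹) y := fun j =>
    indicator_nonneg (fun _ _ => (inv_pos.2 (hr j)).le) y
  refine norm_fderiv_le_of_lip' ℝ (Finset.sum_nonneg fun j _ => hnn j) ?_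
  have hev : ∀ᶠ z in 𝓝 y, ∀ j ∈ J, y ∉ closedBall (x j) (2 * r j) →
      z ∉ closedBall (x j) (2 * r j) := by
    rw [Filter.eventually_all_finset]
    intro j _
    by_cases h : y ∈ closedBall (x j) (2 * r j)
    · exact Eventually.of_forall fun z h' => absurd h h'
    · filter_upwards [isClosed_closedBall.isOpen_compl.mem_nhds h] with z hz _ using hz
  filter_upwards [hev] with z hz
  refine (abs_ballsCutoff_sub_le _ _).trans ?_
  rw [Finset.sum_mul]
  refine Finset.sum_le_sum fun j hj => ?_
  by_cases h : y ∈ closedBall (x j) (2 * r j)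
  · rw [indicator_of_mem h]
    exact abs_tent_sub_le (hr j) _ _
  · rw [indicator_of_notMem h, tent_eq_zero (hr j) h, tent_eq_zero (hr j) (hz j hj h)]
    simp

/-- Each tent has slope at most 1 / r on a ball of volume (2r)^N times that of the unit ball, which
leaves a multiple of r^{N-1}. -/
theorem abs_setIntegral_mul_partialDeriv_ballsCutoff_le [NeZero N] (hr : ∀ j, 0 < r j)
    {Ω : Set (E N)} (hΩ : IsOpen Ω) {h : E N → ℝ} {M : ℝ} (hM : 0 ≤ M)
    (hh : ∀ᵐ y ∂volume, y ∈ Ω → y ∈ ⋃ j ∈ J, closedBall (x j) (2 * r j) → |h y| ≤ M)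
    (s : Fin N) :
    |∫ y in Ω, h y * partialDeriv s (ballsCutoff J x r) y| ≤
      M * (2 ^ N * volume.real (ball (0 : E N) 1)) * ∑ j ∈ J, r j ^ (N - 1) := by
  have hint : ∀ j, Integrable ((closedBall (x j) (2 * r j)).indicator fun _ => (r j)⁻¹) volume :=
    fun j => (integrable_indicator_iff measurableSet_closedBall).2
      (integrableOn_const measure_closedBall_lt_top.ne)
  have hsum : Integrable (fun y => M * ∑ j ∈ J,
      (closedBall (x j) (2 * r j)).indicator (fun _ => (r j)⁻¹) y) volume :=
    (integrable_finsetSum _ fun j _ => hint j).const_mul M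
  have hnn : ∀ y, 0 ≤ ∑ j ∈ J, (closedBall (x j) (2 * r j)).indicator (fun _ => (r j)⁻¹) y :=
    fun y => Finset.sum_nonneg fun j _ => indicator_nonneg (fun _ _ => (inv_pos.2 (hr j)).le) y
  calc |∫ y in Ω, h y * partialDeriv s (ballsCutoff J x r) y|
      ≤ ∫ y in Ω, M * ∑ j ∈ J, (closedBall (x j) (2 * r j)).indicator (fun _ => (r j)⁻¹) y := by
        rw [← Real.norm_eq_abs]
        refine norm_integral_le_of_norm_le hsum.integrableOn ?_
        rw [ae_restrict_iff' hΩ.measurableSet]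
        filter_upwards [hh] with y hy hyΩ
        have h1 := (abs_partialDeriv_le s (ballsCutoff J x r) y).trans
          (norm_fderiv_ballsCutoff_le hr y)
        rw [norm_mul, Real.norm_eq_abs, Real.norm_eq_abs]
        by_cases hyJ : y ∈ ⋃ j ∈ J, closedBall (x j) (2 * r j)
        · exact mul_le_mul (hy hyΩ hyJ) h1 (abs_nonneg _) hM
        · have h2 : ∑ j ∈ J, (closedBall (x j) (2 * r j)).indicator (fun _ => (r j)⁻¹) y = 0 :=
            Finset.sum_eq_zero fun j hj =>
              indicator_of_notMem (fun h => hyJ (mem_iUnion₂.2 ⟨j, hj, h⟩)) _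
          rw [h2] at h1 ⊢
          rw [le_antisymm h1 (abs_nonneg _)]
          simp
    _ ≤ ∫ y, M * ∑ j ∈ J, (closedBall (x j) (2 * r j)).indicator (fun _ => (r j)⁻¹) y :=
        setIntegral_le_integral hsum (Eventually.of_forall fun y => mul_nonneg hM (hnn y))
    _ = _ := by
        rw [integral_const_mul, integral_finsetSum _ fun j _ => hint j, mul_assoc,
          Finset.mul_sum (a := 2 ^ N * volume.real (ball (0 : E N) 1))]
        refine congrArg (M * ·) (Finset.sum_congr rfl fun j _ => ?_)
        rw [integral_indicator measurableSet_closedBall, setIntegral_const,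
          Measure.addHaar_real_closedBall _ _ (by linarith [hr j]), finrank_euclideanSpace_fin]
        have hp : r j ^ N = r j ^ (N - 1) * r j := (pow_sub_one_mul (NeZero.ne N) _).symm
        have hrj := (hr j).ne'
        rw [smul_eq_mul, mul_pow, hp]
        field_simp

end ballsCutoff

/-- With cutoffs φ_n from covers by balls with ∑ r^{N-1} ≤ 1 / (n + 1), μ(K) is the limit of ∫ φ_n
dμ = -∫ h ∂_sφ_n, and boundedness of `h` sends this to zero. -/
theorem IsDistribDeriv.eval_eq_zero [NeZero N] {Ω : Set (E N)} (hΩ : IsOpen Ω) {h : E N → ℝ}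
    (hb : ∀ K ⊆ Ω, IsCompact K → ∃ M : ℝ, ∀ᵐ y ∂volume, y ∈ K → |h y| ≤ M)
    {s : Fin N} {μ : SignedPair N} (hμ : IsDistribDeriv Ω h s μ) {K : Set (E N)}
    (hK : IsCompact K) (hKΩ : K ⊆ Ω) (h0 : IsHausdorffNull K) : μ.eval K = 0 := by
  obtain ⟨δ₀, hδ₀, hsub⟩ := hK.exists_cthickening_subset_open hΩ hKΩ
  obtain ⟨M', hM'⟩ := hb _ hsub hK.cthickening
  have hu : ∀ c : ℝ, Tendsto (fun n : ℕ => c / ((n : ℝ) + 1)) atTop (𝓝 0) := fun c =>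
    tendsto_const_div_atTop_nhds_zero_nat c |>.comp (tendsto_add_atTop_nat 1) |>.congr
      fun n => by simp
  have hpos : ∀ c : ℝ, 0 < c → ∀ n : ℕ, 0 < c / ((n : ℝ) + 1) := fun c hc n => by positivity
  choose ι J x r hx hr hcov hsum using fun n : ℕ =>
    -- Half the thickening radius, because the tents live on the doubled balls.
    h0.exists_finite_cover hK (hpos 1 one_pos n) (half_pos (hpos δ₀ hδ₀ n))
  have hle : ∀ n : ℕ, δ₀ / ((n : ℝ) + 1) ≤ δ₀ := fun n =>
    div_le_self hδ₀.le (by linarith [(n.cast_nonneg : (0 : ℝ) ≤ n)])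
  have hball : ∀ n j, closedBall (x n j) (2 * r n j) ⊆ cthickening (δ₀ / (n + 1)) K :=
    fun n j => (closedBall_subset_closedBall (by linarith [(hr n j).2])).trans
      (closedBall_subset_cthickening (hx n j) _)
  choose L hL using fun n => exists_lipschitzWith_ballsCutoff (J := J n) (x := x n)
    (fun j => (hr n j).1)
  have hzero : ∀ n : ℕ, ∀ y ∉ cthickening (δ₀ / (n + 1)) K, ballsCutoff (J n) (x n) (r n) y = 0 :=
    fun n y hy => ballsCutoff_eq_zero (fun j => (hr n j).1) fun j _ h => hy (hball n j h)
  have hlim := hμ.1.tendsto_integral_cutoff hΩ hK hKΩ (hu δ₀)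
    (fun n => (hL n).continuous)
    (fun n y hy => ballsCutoff_eq_one (fun j => (hr n j).1) (hcov n hy))
    (fun n y => ballsCutoff_mem_Icc y) hzero
  refine tendsto_nhds_unique hlim ?_
  set C := max M' 0 * (2 ^ N * volume.real (ball (0 : E N) 1))
  refine squeeze_zero_norm (a := fun n : ℕ => C * (1 / ((n : ℝ) + 1))) (fun n => ?_)
    (by simpa only [mul_zero] using (hu 1).const_mul C)
  have h1 := hμ.2 _ (isLipTest_of_cutoff hK ((cthickening_mono (hle n) K).trans hsub) (hL n)
    (hzero n))
  rw [eq_neg_iff_add_eq_zero, add_comm, ← eq_neg_iff_add_eq_zero] at h1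
  rw [h1, norm_neg, Real.norm_eq_abs]
  refine (abs_setIntegral_mul_partialDeriv_ballsCutoff_le (fun j => (hr n j).1) hΩ
    (le_max_right M' 0) ?_ s).trans (mul_le_mul_of_nonneg_left (hsum n) (by positivity))
  filter_upwards [hM'] with y hy _ hyJ
  obtain ⟨j, -, hyj⟩ := mem_iUnion₂.1 hyJ
  exact (hy (cthickening_mono (hle n) K (hball n j hyj))).trans (le_max_left _ _)

/-- A function of class `C_w` is essentially bounded on compact sets. -/
theorem MemCw.exists_ae_bound {Ω : Set (E N)} {h : E N → ℝ} (hh : MemCw Ω h) {K : Set (E N)}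
    (hKΩ : K ⊆ Ω) (hK : IsCompact K) : ∃ M : ℝ, ∀ᵐ y ∂volume, y ∈ K → |h y| ≤ M := by
  obtain ⟨S, hS, -, hb⟩ := hh
  have hS0 : ∀ᵐ y ∂(volume : Measure (E N)), y ∉ S :=
    measure_eq_zero_iff_ae_notMem.1 hS.volume_eq_zero
  suffices ∃ M : ℝ, ∀ y ∈ K \ S, |h y| ≤ M by
    obtain ⟨M, hM⟩ := this
    exact ⟨M, hS0.mono fun y hy hyK => hM y ⟨hyK, hy⟩⟩
  refine hK.induction_on (p := fun K => ∃ M : ℝ, ∀ y ∈ K \ S, |h y| ≤ M) ⟨0, by simp⟩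
    (fun s t hst ⟨M, hM⟩ => ⟨M, fun y hy => hM y ⟨hst hy.1, hy.2⟩⟩) ?_ ?_
  · rintro s t ⟨M, hM⟩ ⟨M', hM'⟩
    refine ⟨max M M', fun y hy => ?_⟩
    rcases hy.1 with h1 | h1
    · exact (hM y ⟨h1, hy.2⟩).trans (le_max_left _ _)
    · exact (hM' y ⟨h1, hy.2⟩).trans (le_max_right _ _)
  · intro x hx
    obtain ⟨r, hr, -, M, hM⟩ := hb x (hKΩ hx)
    exact ⟨ball x r, mem_nhdsWithin_of_mem_nhds (ball_mem_nhds x hr), M, hM⟩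

/-! ### Bounded Borel functions with compact support -/

/-- `a` is a bounded Borel function vanishing off `K`. -/
structure IsBddSupportedOn (K : Set (E N)) (a : E N → ℝ) : Prop where
  measurable : Measurable a
  exists_bound : ∃ C, ∀ y, |a y| ≤ C
  eq_zero : ∀ y ∉ K, a y = 0

namespace IsBddSupportedOn

variable {K : Set (E N)} {a : E N → ℝ}

theorem mono (ha : IsBddSupportedOn K a) {K' : Set (E N)} (h : K ⊆ K') : IsBddSupportedOn K' a :=
  ⟨ha.1, ha.2, fun y hy => ha.3 y fun h' => hy (h h')⟩

theorem mul (ha : IsBddSupportedOn K a) {b : E N → ℝ} (hb : Measurable b)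
    (hbd : ∃ C, ∀ y ∈ K, |b y| ≤ C) : IsBddSupportedOn K fun y => a y * b y := by
  obtain ⟨C, hC⟩ := ha.exists_bound
  obtain ⟨D, hD⟩ := hbd
  refine ⟨ha.measurable.mul hb, ⟨C * max D 0, fun y => ?_⟩, fun y hy => by simp [ha.eq_zero y hy]⟩
  by_cases hy : y ∈ K
  · rw [abs_mul]
    exact mul_le_mul (hC y) ((hD y hy).trans (le_max_left _ _)) (abs_nonneg _)
      ((abs_nonneg _).trans (hC y))
  · rw [ha.eq_zero y hy, zero_mul, abs_zero]
    exact mul_nonneg ((abs_nonneg _).trans (hC y)) (le_max_right _ _)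

theorem integrableOn (ha : IsBddSupportedOn K a) {m : Measure (E N)} {T : Set (E N)}
    (hT : m T < ∞) : IntegrableOn a T m := by
  obtain ⟨C, hC⟩ := ha.exists_bound
  exact Measure.integrableOn_of_bounded hT.ne ha.measurable.aestronglyMeasurable
    (M := C) (Eventually.of_forall hC)

theorem integrable_mul (ha : IsBddSupportedOn K a) (hK : IsCompact K) {ψ : E N → ℝ}
    (hψ : Continuous ψ) : Integrable (fun y => a y * ψ y) volume := by
  have h1 : IntegrableOn (fun y => a y * ψ y) K volume :=
    (ha.integrableOn hK.measure_lt_top).mul_continuousOn hψ.continuousOn hK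
  refine (integrableOn_iff_integrable_of_support_subset fun y hy => ?_).1 h1
  by_contra h
  exact hy (by simp [ha.eq_zero y h])

theorem integrable (ha : IsBddSupportedOn K a) (hK : IsCompact K) : Integrable a volume := by
  simpa using ha.integrable_mul hK (ψ := fun _ => 1) continuous_const

theorem integrableOn_mul_left (ha : IsBddSupportedOn K a) (hK : IsCompact K) {Ω : Set (E N)}
    (hKΩ : K ⊆ Ω) {h : E N → ℝ} (hh : LocallyIntegrableOn h Ω volume) :
    IntegrableOn (fun y => h y * a y) Ω volume := by
  obtain ⟨C, hC⟩ := ha.exists_bound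
  have h1 : Integrable (fun y => h y * a y) (volume.restrict K) :=
    (hh.integrableOn_compact_subset hKΩ hK).mul_bdd ha.measurable.aestronglyMeasurable
      (Eventually.of_forall hC)
  have h2 : Integrable (fun y => h y * a y) volume := by
    refine (integrableOn_iff_integrable_of_support_subset (s := K) fun y hy => ?_).1 h1
    by_contra h
    exact hy (by simp [ha.eq_zero y h])
  exact h2.integrableOn

end IsBddSupportedOn

theorem IsLipTest.abs_le {Ω : Set (E N)} {φ : E N → ℝ} (hφ : IsLipTest Ω φ) :
    ∃ C, ∀ y, |φ y| ≤ C := by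
  obtain ⟨⟨L, hL⟩, hc, -⟩ := hφ
  exact hc.exists_bound_of_continuous hL.continuous

theorem IsLipTest.isBddSupportedOn {Ω : Set (E N)} {φ : E N → ℝ} (hφ : IsLipTest Ω φ) :
    IsBddSupportedOn (tsupport φ) φ :=
  ⟨hφ.1.choose_spec.continuous.measurable, hφ.abs_le, fun _ hy => image_eq_zero_of_notMem_tsupport hy⟩

theorem IsLipTest.isBddSupportedOn_partialDeriv {Ω : Set (E N)} {φ : E N → ℝ}
    (hφ : IsLipTest Ω φ) (i : Fin N) : IsBddSupportedOn (tsupport φ) (partialDeriv i φ) := by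
  obtain ⟨⟨L, hL⟩, -, -⟩ := hφ
  refine ⟨measurable_partialDeriv i φ, ⟨L, fun y => (abs_partialDeriv_le i φ y).trans
    (norm_fderiv_le_of_lipschitz ℝ hL)⟩, fun y hy => ?_⟩
  have : fderiv ℝ φ y = 0 := by
    have := image_eq_zero_of_notMem_tsupport (f := fderiv ℝ φ)
      (fun h => hy (tsupport_fderiv_subset ℝ h))
    exact this
  simp [partialDeriv, this]

/-! ### Change of variables -/

section ChangeOfVariables

variable {F : OpenPartialHomeomorph (E N) (E N)}

/-- The change of variables formula asks for a derivative at every point. The bad set is null by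
Rademacher, and so is its image under a locally Lipschitz map. -/
theorem image_differentiable_ae_eq (hG : LocallyLipschitzOn F.target F.symm) {T : Set (E N)}
    (hT : T ⊆ F.target) :
    (F.symm '' (T ∩ {y | DifferentiableAt ℝ F.symm y}) : Set (E N)) =ᵐ[volume] F.symm '' T := by
  have h0 : volume (F.symm '' {y | y ∈ F.target ∧ ¬ DifferentiableAt ℝ F.symm y}) = 0 :=
    volume_image_eq_zero hG (fun y hy => hy.1)
      (volume_not_differentiableAt_eq_zero F.open_target hG)
  refine eventuallyEq_set.2 ?_
  filter_upwards [measure_eq_zero_iff_ae_notMem.1 h0] with x hx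
  refine ⟨fun h => image_mono inter_subset_left h, ?_⟩
  rintro ⟨y, hy, rfl⟩
  refine ⟨y, ⟨hy, by_contra fun h => hx ⟨y, ⟨hT hy, h⟩, rfl⟩⟩, rfl⟩

theorem inter_differentiable_ae_eq (hG : LocallyLipschitzOn F.target F.symm) {T : Set (E N)}
    (hT : T ⊆ F.target) :
    (T ∩ {y | DifferentiableAt ℝ F.symm y} : Set (E N)) =ᵐ[volume] T := by
  refine eventuallyEq_set.2 ?_
  filter_upwards [measure_eq_zero_iff_ae_notMem.1
    (volume_not_differentiableAt_eq_zero F.open_target hG)] with y hy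
  exact ⟨fun h => h.1, fun h => ⟨h, by_contra fun h' => hy ⟨hT h, h'⟩⟩⟩

theorem integrableOn_image_symm_iff (hG : LocallyLipschitzOn F.target F.symm) {T : Set (E N)}
    (hT : T ⊆ F.target) (hTm : MeasurableSet T) (f : E N → ℝ) :
    IntegrableOn f (F.symm '' T) volume ↔
      IntegrableOn (fun y => |(fderiv ℝ F.symm y).det| * f (F.symm y)) T volume := by
  have h := integrableOn_image_iff_integrableOn_abs_det_fderiv_smul volume
    (hTm.inter (measurableSet_of_differentiableAt ℝ F.symm))
    (fun y hy => hy.2.hasFDerivAt.hasFDerivWithinAt)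
    (F.symm.injOn.mono (inter_subset_left.trans hT)) f
  rw [integrableOn_congr_set_ae (image_differentiable_ae_eq hG hT),
    integrableOn_congr_set_ae (inter_differentiable_ae_eq hG hT)] at h
  exact h

theorem setIntegral_source_eq (hG : LocallyLipschitzOn F.target F.symm) (f : E N → ℝ) :
    ∫ x in F.source, f x =
      ∫ y in F.target, |(fderiv ℝ F.symm y).det| * f (F.symm y) := by
  have h := integral_image_eq_integral_abs_det_fderiv_smul volume
    (F.open_target.measurableSet.inter (measurableSet_of_differentiableAt ℝ F.symm))
    (fun y hy => hy.2.hasFDerivAt.hasFDerivWithinAt)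
    (F.symm.injOn.mono inter_subset_left) f
  rw [setIntegral_congr_set (image_differentiable_ae_eq hG subset_rfl),
    setIntegral_congr_set (inter_differentiable_ae_eq hG subset_rfl),
    F.symm_image_target_eq_source] at h
  exact h

theorem locallyIntegrableOn_comp (hG : LocallyLipschitzOn F.target F.symm) {h : E N → ℝ}
    (hh : LocallyIntegrableOn h F.target volume) :
    LocallyIntegrableOn (h ∘ F) F.source volume := by
  rw [locallyIntegrableOn_iff F.open_source.isLocallyClosed]
  intro L hL hLc
  have hKc : IsCompact (F '' L) := hLc.image_of_continuousOn (F.continuousOn.mono hL)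
  have hKV : F '' L ⊆ F.target := by
    rintro _ ⟨x, hx, rfl⟩
    exact F.map_source (hL hx)
  have himg : F.symm '' (F '' L) = L := F.symm_image_image_of_subset_source hL
  rw [← himg, integrableOn_image_symm_iff hG hKV hKc.measurableSet]
  obtain ⟨D, -, hD⟩ := exists_bound_det_fderiv F.open_target hG hKc hKV
  have h1 : IntegrableOn (fun y => |(fderiv ℝ F.symm y).det| * h y) (F '' L) volume := by
    refine (hh.integrableOn_compact_subset hKV hKc).bdd_mul (c := D)
      (continuous_abs.measurable.comp (measurable_det_fderiv _)).aestronglyMeasurable ?_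
    rw [ae_restrict_iff' hKc.measurableSet]
    exact Eventually.of_forall fun y hy => by simpa using hD y hy
  refine h1.congr_fun (fun y hy => ?_) hKc.measurableSet
  simp only [Function.comp_apply, F.right_inv (hKV hy)]

/-- The density of `f dx` transported by `F`. -/
def pushDensity (F : OpenPartialHomeomorph (E N) (E N)) (f : E N → ℝ) : E N → ℝ :=
  F.target.indicator fun y => |(fderiv ℝ F.symm y).det| * f (F.symm y)

theorem setIntegral_mul_pushDensity (hG : LocallyLipschitzOn F.target F.symm) (h f : E N → ℝ) :
    ∫ y in F.target, h y * pushDensity F f y = ∫ x in F.source, h (F x) * f x := by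
  rw [setIntegral_source_eq hG]
  refine setIntegral_congr_fun F.open_target.measurableSet fun y hy => ?_
  simp only [pushDensity, indicator_of_mem hy, F.right_inv hy]
  ring

theorem measurable_pushDensity {f : E N → ℝ} (hf : Measurable f) :
    Measurable (pushDensity F f) := by
  classical
  -- Nothing is known about `F.symm` off the target, so it is replaced by a constant there.
  have h1 : Measurable (F.target.piecewise F.symm fun _ => 0) :=
    F.continuousOn_symm.measurable_piecewise continuousOn_const F.open_target.measurableSet
  have h2 : pushDensity F f = F.target.indicator fun y =>
      |(fderiv ℝ F.symm y).det| * f (F.target.piecewise F.symm (fun _ => 0) y) := by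
    refine indicator_congr fun y hy => ?_
    rw [piecewise_eq_of_mem _ _ _ hy]
  rw [h2]
  exact ((continuous_abs.measurable.comp (measurable_det_fderiv _)).mul (hf.comp h1)).indicator
    F.open_target.measurableSet

theorem IsBddSupportedOn.pushDensity (hG : LocallyLipschitzOn F.target F.symm) {K : Set (E N)}
    (hK : IsCompact K) (hKU : K ⊆ F.source) {f : E N → ℝ} (hf : IsBddSupportedOn K f) :
    IsBddSupportedOn (F '' K) (pushDensity F f) := by
  have hzero : ∀ y ∉ F '' K, DCCalculus.pushDensity F f y = 0 := by
    intro y hy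
    by_cases hyV : y ∈ F.target
    · rw [DCCalculus.pushDensity, indicator_of_mem hyV, hf.eq_zero, mul_zero]
      exact fun h => hy ⟨_, h, F.right_inv hyV⟩
    · exact indicator_of_notMem hyV _
  refine ⟨measurable_pushDensity hf.measurable, ?_, hzero⟩
  have hKc : IsCompact (F '' K) := hK.image_of_continuousOn (F.continuousOn.mono hKU)
  have hKV : F '' K ⊆ F.target := by
    rintro _ ⟨x, hx, rfl⟩
    exact F.map_source (hKU hx)
  obtain ⟨D, hD0, hD⟩ := exists_bound_det_fderiv F.open_target hG hKc hKV
  obtain ⟨C, hC⟩ := hf.exists_bound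
  have hC0 : 0 ≤ C := (abs_nonneg _).trans (hC 0)
  refine ⟨D * C, fun y => ?_⟩
  by_cases hy : y ∈ F '' K
  · rw [DCCalculus.pushDensity, indicator_of_mem (hKV hy), abs_mul, abs_abs]
    exact mul_le_mul (hD y hy) (hC _) (abs_nonneg _) hD0
  · rw [hzero y hy, abs_zero]
    positivity

end ChangeOfVariables

/-! ### Integration by parts -/

/-- Compactness gives a Lipschitz constant on the 1-thickening of the support. A point outside it
has distance at least 1 from the support, so there the sup bound M is at most M times the distance.
-/
theorem exists_lipschitzWith_of_hasCompactSupport {Ω : Set (E N)} (hΩ : IsOpen Ω) {g : E N → ℝ}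
    (hg : LocallyLipschitzOn Ω g) (hc : HasCompactSupport g) (hsub : tsupport g ⊆ Ω) :
    ∃ L, LipschitzWith L g := by
  have hloc : LocallyLipschitz g := by
    intro x
    by_cases hx : x ∈ Ω
    · obtain ⟨K, t, ht, hK⟩ := hg hx
      exact ⟨K, t, by rwa [hΩ.nhdsWithin_eq hx] at ht, hK⟩
    · refine ⟨0, (tsupport g)ᶜ, (isClosed_tsupport g).isOpen_compl.mem_nhds
        fun h => hx (hsub h), fun y hy z hz => ?_⟩
      rw [image_eq_zero_of_notMem_tsupport hy, image_eq_zero_of_notMem_tsupport hz]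
      simp
  obtain ⟨C, hC⟩ := hloc.locallyLipschitzOn.exists_lipschitzOnWith_of_compact
    (hc.isCompact.cthickening (r := 1))
  obtain ⟨M, hM⟩ := hc.exists_bound_of_continuous hloc.continuous
  have hM0 : 0 ≤ M := (norm_nonneg _).trans (hM 0)
  have key : ∀ x ∈ tsupport g, ∀ y, dist (g x) (g y) ≤ (C + M) * dist x y := by
    intro x hx y
    by_cases hy : y ∈ cthickening 1 (tsupport g)
    · refine (hC.dist_le_mul x (self_subset_cthickening _ hx) y hy).trans ?_
      gcongr
      linarith
    · have h1 : 1 ≤ dist x y := by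
        by_contra! h
        exact hy (closedBall_subset_cthickening hx 1 (by rw [mem_closedBall, dist_comm]; exact h.le))
      have h2 : g y = 0 := image_eq_zero_of_notMem_tsupport
        fun h => hy (self_subset_cthickening _ h)
      rw [h2, dist_zero_right]
      refine (hM x).trans ?_
      have : (0 : ℝ) ≤ C := C.2
      nlinarith
  refine ⟨C + M.toNNReal, LipschitzWith.of_dist_le_mul fun x y => ?_⟩
  rw [NNReal.coe_add, Real.coe_toNNReal _ hM0]
  by_cases hx : x ∈ tsupport g
  · exact key x hx y
  · by_cases hy : y ∈ tsupport g
    · rw [dist_comm, dist_comm x]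
      exact key y hy x
    · rw [image_eq_zero_of_notMem_tsupport hx, image_eq_zero_of_notMem_tsupport hy, dist_self]
      positivity

theorem integral_partialDeriv_eq_zero {g : E N → ℝ} {L : ℝ≥0} (hg : LipschitzWith L g)
    (hc : HasCompactSupport g) (i : Fin N) : ∫ x, partialDeriv i g x = 0 := by
  -- Integration by parts against the constant 1; the formula reverses the direction, hence the
  -- minus sign.
  have h := LipschitzWith.integral_lineDeriv_mul_eq (μ := (volume : Measure (E N)))
    (LipschitzWith.const (1 : ℝ)) hg hc (-EuclideanSpace.single i 1)
  have hz : ∀ x v : E N, lineDeriv ℝ (fun _ : E N => (1 : ℝ)) x v = 0 := fun x v => by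
    simp [lineDeriv]
  simp only [neg_neg, mul_one, hz, zero_mul, integral_zero] at h
  refine Eq.trans (integral_congr_ae ?_) h.symm
  filter_upwards [hg.ae_differentiableAt (μ := volume)] with x hx
  exact hx.lineDeriv_eq_fderiv.symm

/-- The chain rule at a point of differentiability, in coordinates. -/
theorem partialDeriv_comp {F : E N → E N} {ψ : E N → ℝ} {x : E N} (hF : DifferentiableAt ℝ F x)
    (hψ : DifferentiableAt ℝ ψ (F x)) (i : Fin N) :
    partialDeriv i (ψ ∘ F) x =
      ∑ s, partialDeriv i (fun x => F x s) x * partialDeriv s ψ (F x) := by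
  rw [partialDeriv, fderiv_comp x hψ hF, ContinuousLinearMap.comp_apply]
  set v := fderiv ℝ F x (EuclideanSpace.single i 1) with hv
  have h1 : v = ∑ s, v s • EuclideanSpace.single s (1 : ℝ) := by
    have := (EuclideanSpace.basisFun (Fin N) ℝ).sum_repr v
    simpa using this.symm
  conv_lhs => rw [h1]
  rw [map_sum]
  refine Finset.sum_congr rfl fun s _ => ?_
  rw [map_smul, smul_eq_mul, partialDeriv_component hF, partialDeriv]

theorem LocallyLipschitzOn.comp_left {Ω : Set (E N)} {α β : Type*} [PseudoMetricSpace α]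
    [PseudoMetricSpace β] {g : E N → α} {f : α → β} (hf : LocallyLipschitz f)
    (hg : LocallyLipschitzOn Ω g) : LocallyLipschitzOn Ω (f ∘ g) := by
  intro x hx
  obtain ⟨K, t, ht, hK⟩ := hg hx
  obtain ⟨C, u, hu, hC⟩ := hf (g x)
  refine ⟨C * K, t ∩ g ⁻¹' u, inter_mem ht (hg.continuousOn x hx hu), ?_⟩
  exact hC.comp (hK.mono inter_subset_left) fun y hy => hy.2

theorem locallyLipschitzOn_mul {Ω : Set (E N)} {f g : E N → ℝ} (hf : LocallyLipschitzOn Ω f)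
    (hg : LocallyLipschitzOn Ω g) : LocallyLipschitzOn Ω fun x => f x * g x := by
  have h1 : LocallyLipschitzOn Ω fun x => (f x, g x) := by
    intro x hx
    obtain ⟨K, t, ht, hK⟩ := hf hx
    obtain ⟨C, u, hu, hC⟩ := hg hx
    refine ⟨max K C, t ∩ u, inter_mem ht hu, fun y hy z hz => ?_⟩
    rw [Prod.edist_eq, ENNReal.coe_max, max_mul]
    exact max_le_max (hK hy.1 hz.1) (hC hy.2 hz.2)
  have h2 : LocallyLipschitz fun p : ℝ × ℝ => p.1 * p.2 :=
    (contDiff_fst.mul contDiff_snd : ContDiff ℝ 1 fun p : ℝ × ℝ => p.1 * p.2).locallyLipschitz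
  exact LocallyLipschitzOn.comp_left h2 h1

theorem IsLipTest.isBddSupportedOn_mul_partialDeriv {F : OpenPartialHomeomorph (E N) (E N)}
    (hF : LocallyLipschitzOn F.source F) {φ : E N → ℝ} (hφ : IsLipTest F.source φ) (i s : Fin N) :
    IsBddSupportedOn (tsupport φ) fun x => φ x * partialDeriv i (fun x => F x s) x := by
  refine hφ.isBddSupportedOn.mul (measurable_partialDeriv i _) ?_
  have hFs : LocallyLipschitzOn F.source fun x => F x s :=
    LocallyLipschitzOn.comp_left (EuclideanSpace.proj (𝕜 := ℝ) s).lipschitz.locallyLipschitz hF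
  obtain ⟨C, -, hC⟩ := exists_bound_partialDeriv F.open_source hFs hφ.2.1 hφ.2.2 i
  exact ⟨C, hC⟩

/-- Moved to the source, the two sides combine, by the product and chain rules almost everywhere,
into the integral of ∂_i(φ · (ψ ∘ F)), a compactly supported Lipschitz function. -/
theorem integral_pushDensity_divergence {F : OpenPartialHomeomorph (E N) (E N)}
    (hF : LocallyLipschitzOn F.source F) (hG : LocallyLipschitzOn F.target F.symm)
    {φ : E N → ℝ} (hφ : IsLipTest F.source φ) (i : Fin N) {ψ : E N → ℝ} (hψ : ContDiff ℝ 1 ψ) :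
    ∫ y, pushDensity F (partialDeriv i φ) y * ψ y =
      -∑ s, ∫ y, pushDensity F (fun x => φ x * partialDeriv i (fun x => F x s) x) y *
        partialDeriv s ψ y := by
  have hKc : IsCompact (F '' tsupport φ) :=
    hφ.2.1.isCompact.image_of_continuousOn (F.continuousOn.mono hφ.2.2)
  have hB := (hφ.isBddSupportedOn_partialDeriv i).pushDensity hG hφ.2.1 hφ.2.2
  have hA := fun s => (hφ.isBddSupportedOn_mul_partialDeriv hF i s).pushDensity hG hφ.2.1 hφ.2.2
  have hψs : ∀ s, Continuous (partialDeriv s ψ) := fun s =>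
    (hψ.continuous_fderiv one_ne_zero).clm_apply continuous_const
  rw [eq_neg_iff_add_eq_zero, ← integral_finsetSum _ fun s _ => (hA s).integrable_mul hKc (hψs s),
    ← integral_add (hB.integrable_mul hKc hψ.continuous)
      (integrable_finsetSum _ fun s _ => (hA s).integrable_mul hKc (hψs s))]
  have hoff : ∀ (f : E N → ℝ), ∀ y ∉ F.target, pushDensity F f y = 0 := fun f y hy =>
    indicator_of_notMem hy _
  rw [← setIntegral_eq_integral_of_forall_compl_eq_zero (s := F.target)
    (fun y hy => by simp [hoff _ y hy])]
  have h1 := setIntegral_source_eq hG fun x => partialDeriv i φ x * ψ (F x) +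
    ∑ s, φ x * partialDeriv i (fun x => F x s) x * partialDeriv s ψ (F x)
  have h2 : ∫ y in F.target, (pushDensity F (partialDeriv i φ) y * ψ y +
      ∑ s, pushDensity F (fun x => φ x * partialDeriv i (fun x => F x s) x) y *
        partialDeriv s ψ y) = ∫ x in F.source, (partialDeriv i φ x * ψ (F x) +
    ∑ s, φ x * partialDeriv i (fun x => F x s) x * partialDeriv s ψ (F x)) := by
    rw [h1]
    refine setIntegral_congr_fun F.open_target.measurableSet fun y hy => ?_
    simp only [pushDensity, indicator_of_mem hy, F.right_inv hy, mul_add, Finset.mul_sum, mul_assoc]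
  rw [h2]
  set g : E N → ℝ := fun x => φ x * ψ (F x) with hg
  have hgsupp : tsupport g ⊆ tsupport φ := tsupport_mul_subset_left
  have hgc : HasCompactSupport g := hφ.2.1.mul_right
  obtain ⟨L, hL⟩ := hφ.1
  have hgl : LocallyLipschitzOn F.source g :=
    locallyLipschitzOn_mul hL.locallyLipschitz.locallyLipschitzOn
      (LocallyLipschitzOn.comp_left hψ.locallyLipschitz hF)
  obtain ⟨L', hL'⟩ := exists_lipschitzWith_of_hasCompactSupport F.open_source hgl hgc
    (hgsupp.trans hφ.2.2)
  have hgt : IsLipTest F.source g := ⟨⟨L', hL'⟩, hgc, hgsupp.trans hφ.2.2⟩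
  rw [← integral_partialDeriv_eq_zero hL' hgc i,
    ← setIntegral_eq_integral_of_forall_compl_eq_zero (s := F.source) (fun x hx =>
      (hgt.isBddSupportedOn_partialDeriv i).eq_zero x fun h => hx (hgt.2.2 h))]
  refine setIntegral_congr_ae F.open_source.measurableSet ?_
  filter_upwards [hL.ae_differentiableAt (μ := volume), measure_eq_zero_iff_ae_notMem.1
    (volume_not_differentiableAt_eq_zero F.open_source hF)] with x hx1 hx2 hxU
  have hFx : DifferentiableAt ℝ F x := by_contra fun h => hx2 ⟨hxU, h⟩
  have hψx : DifferentiableAt ℝ ψ (F x) := hψ.differentiable one_ne_zero _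
  have h3 : partialDeriv i g x = φ x * partialDeriv i (ψ ∘ F) x + ψ (F x) * partialDeriv i φ x := by
    have := fderiv_mul hx1 (hψx.comp x hFx)
    have h4 : g = φ * (ψ ∘ F) := rfl
    simp [partialDeriv, h4, this]
  rw [h3, partialDeriv_comp hFx hψx, Finset.mul_sum]
  simp only [mul_assoc]
  ring

/-! ### Mollification -/

/-- The convolution of `a` with a normalized bump function. -/
def mollify (ρ : ContDiffBump (0 : E N)) (a : E N → ℝ) (y : E N) : ℝ :=
  ∫ t, a t * ρ.normed volume (y - t)

section mollify

open scoped Convolution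

variable {ρ : ContDiffBump (0 : E N)} {K : Set (E N)} {a : E N → ℝ}

theorem mollify_eq_convolution :
    mollify ρ a = a ⋆[ContinuousLinearMap.lsmul ℝ ℝ, volume] ρ.normed volume := rfl

theorem mollify_eq_convolution_swap (y : E N) :
    mollify ρ a y = (ρ.normed volume ⋆[ContinuousLinearMap.lsmul ℝ ℝ, volume] a) y := by
  rw [convolution_lsmul_swap]
  exact integral_congr_ae (Eventually.of_forall fun t => mul_comm _ _)

theorem contDiff_mollify (ha : LocallyIntegrable a volume) : ContDiff ℝ 1 (mollify ρ a) := by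
  rw [mollify_eq_convolution]
  exact ρ.hasCompactSupport_normed.contDiff_convolution_right _ ha ρ.contDiff_normed

theorem partialDeriv_mollify (ha : LocallyIntegrable a volume) (s : Fin N) (y : E N) :
    partialDeriv s (mollify ρ a) y = ∫ t, a t * partialDeriv s (ρ.normed volume) (y - t) := by
  have hρ : ContDiff ℝ 1 (ρ.normed volume) := ρ.contDiff_normed
  rw [partialDeriv, mollify_eq_convolution,
    (ρ.hasCompactSupport_normed.hasFDerivAt_convolution_right _ ha hρ y).fderiv,
    convolution_precompR_apply _ ha (ρ.hasCompactSupport_normed.fderiv ℝ)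
      (hρ.continuous_fderiv one_ne_zero)]
  rfl

theorem mollify_eq_zero (ha : ∀ t ∉ K, a t = 0) {y : E N} (hy : y ∉ cthickening ρ.rOut K) :
    mollify ρ a y = 0 := by
  refine integral_eq_zero_of_ae (Eventually.of_forall fun t => ?_)
  by_cases ht : t ∈ K
  · have : ρ.normed volume (y - t) = 0 := by
      refine Function.notMem_support.1 fun h => hy ?_
      rw [ρ.support_normed_eq, mem_ball, dist_zero_right, ← dist_eq_norm] at h
      exact closedBall_subset_cthickening ht _ (mem_closedBall.2 h.le)
    simp [this]
  · simp [ha t ht]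

theorem abs_mollify_le {C : ℝ} (hC : ∀ y, |a y| ≤ C) (y : E N) : |mollify ρ a y| ≤ C := by
  have hint : Integrable (fun t => ρ.normed volume (y - t)) volume :=
    (integrable_comp_sub_left _ y).2 ρ.integrable_normed
  have h1 : ∫ t, C * ρ.normed volume (y - t) = C := by
    rw [integral_const_mul, integral_sub_left_eq_self (fun t => ρ.normed volume t) volume y,
      ρ.integral_normed, mul_one]
  rw [← Real.norm_eq_abs]
  calc ‖mollify ρ a y‖ ≤ ∫ t, C * ρ.normed volume (y - t) := by
        refine norm_integral_le_of_norm_le (hint.const_mul C) (Eventually.of_forall fun t => ?_)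
        rw [norm_mul, Real.norm_eq_abs, Real.norm_of_nonneg (ρ.nonneg_normed _)]
        exact mul_le_mul_of_nonneg_right (hC t) (ρ.nonneg_normed _)
    _ = C := h1

theorem isLipTest_mollify (ha : IsBddSupportedOn K a) (hK : IsCompact K) {Ω : Set (E N)}
    (hsub : cthickening ρ.rOut K ⊆ Ω) : IsLipTest Ω (mollify ρ a) := by
  have h1 : ContDiff ℝ 1 (mollify ρ a) := contDiff_mollify (ha.integrable hK).locallyIntegrable
  have h0 : ∀ y ∉ cthickening ρ.rOut K, mollify ρ a y = 0 := fun y hy =>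
    mollify_eq_zero ha.eq_zero hy
  have hc : HasCompactSupport (mollify ρ a) := HasCompactSupport.intro hK.cthickening h0
  obtain ⟨L, hL⟩ := h1.lipschitzWith_of_hasCompactSupport hc one_ne_zero
  exact isLipTest_of_cutoff hK hsub hL h0

/-- Mollifications converge at every point where the function is continuous off a null set. -/
theorem tendsto_mollify {ρ : ℕ → ContDiffBump (0 : E N)}
    (hρ : Tendsto (fun n => (ρ n).rOut) atTop (𝓝 0)) (ha : Measurable a) {Z : Set (E N)}
    (hZ : volume Z = 0) (hZm : MeasurableSet Z) {y : E N} (hc : ContinuousWithinAt a Zᶜ y) :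
    Tendsto (fun n => mollify (ρ n) a y) atTop (𝓝 (a y)) := by
  classical
  -- Redefining `a` on the null set makes it converge to `a y` along the full neighbourhood filter
  -- without changing its mollifications.
  set a' : E N → ℝ := Z.piecewise (fun _ => a y) a with ha'
  have hae : a' =ᵐ[volume] a := by
    filter_upwards [measure_eq_zero_iff_ae_notMem.1 hZ] with t ht
    exact piecewise_eq_of_notMem _ _ _ ht
  have hcont : Tendsto a' (𝓝 y) (𝓝 (a y)) := by
    rw [← nhdsWithin_univ, ← union_compl_self Z, nhdsWithin_union]
    refine Tendsto.sup ?_ ?_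
    · refine tendsto_const_nhds.congr' ?_
      filter_upwards [self_mem_nhdsWithin] with t ht
      exact (piecewise_eq_of_mem Z (fun _ => a y) a ht).symm
    · refine Tendsto.congr' ?_ hc
      filter_upwards [self_mem_nhdsWithin] with t ht
      exact (piecewise_eq_of_notMem Z (fun _ => a y) a ht).symm
  have ham : Measurable a' := Measurable.piecewise hZm measurable_const ha
  have h1 := ContDiffBump.convolution_tendsto_right (μ := volume) (φ := ρ) (g := fun _ => a')
    (k := fun _ => y) hρ (Eventually.of_forall fun _ => ham.aestronglyMeasurable)
    (hcont.comp tendsto_snd) tendsto_const_nhds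
  refine h1.congr fun n => ?_
  rw [← mollify_eq_convolution_swap]
  refine integral_congr_ae ?_
  filter_upwards [hae] with t ht
  rw [ht]

end mollify

/-- The derivatives of a mollified vector field with bounded divergence `B` sum up to the
mollified divergence. -/
theorem sum_partialDeriv_mollify {K : Set (E N)} (hK : IsCompact K) {A : Fin N → E N → ℝ}
    {B : E N → ℝ} (hA : ∀ s, IsBddSupportedOn K (A s))
    (hdiv : ∀ ψ : E N → ℝ, ContDiff ℝ 1 ψ →
      ∫ y, B y * ψ y = -∑ s, ∫ y, A s y * partialDeriv s ψ y)
    (ρ : ContDiffBump (0 : E N)) (y : E N) :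
    ∑ s, partialDeriv s (mollify ρ (A s)) y = mollify ρ B y := by
  have hρ : ContDiff ℝ 1 (ρ.normed volume) := ρ.contDiff_normed
  have h1 : ContDiff ℝ 1 fun t => ρ.normed volume (y - t) :=
    hρ.comp (contDiff_const.sub contDiff_id)
  -- The weak divergence is tested against t ↦ ρ(y - t), whose derivative in t supplies the sign
  -- that cancels the one in `hdiv`.
  rw [mollify, hdiv _ h1, ← Finset.sum_neg_distrib]
  refine Finset.sum_congr rfl fun s _ => ?_
  rw [partialDeriv_mollify ((hA s).integrable hK).locallyIntegrable, ← integral_neg]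
  refine integral_congr_ae (Eventually.of_forall fun t => ?_)
  have h2 : partialDeriv s (fun t => ρ.normed volume (y - t)) t =
      -partialDeriv s (ρ.normed volume) (y - t) := by
    have h3 := (hρ.differentiable one_ne_zero (y - t)).hasFDerivAt.comp t
      ((hasFDerivAt_id t).const_sub y)
    have h4 : fderiv ℝ (fun t => ρ.normed volume (y - t)) t = _ := h3.fderiv
    simp [partialDeriv, h4]
  simp only [h2, mul_neg, neg_neg]

/-- Integrals of uniformly bounded functions against a signed measure converge under
convergence off a set on which the measure vanishes. -/
theorem SignedPair.IsRadonOn.tendsto_integral {Ω K Z : Set (E N)} (hΩ : IsOpen Ω)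
    (hK : IsCompact K) (hKΩ : K ⊆ Ω) {μ : SignedPair N} (hμ : μ.IsRadonOn Ω)
    (hZ : MeasurableSet Z) (h0 : ∀ C ⊆ K ∩ Z, IsCompact C → μ.eval C = 0)
    {f : ℕ → E N → ℝ} {g : E N → ℝ} {C : ℝ} (hf : ∀ᶠ n in atTop, Measurable (f n))
    (hfb : ∀ᶠ n in atTop, ∀ y, |f n y| ≤ C) (hf0 : ∀ᶠ n in atTop, ∀ y ∉ K, f n y = 0)
    (hg : IsBddSupportedOn K g) (hlim : ∀ y ∉ Z, Tendsto (fun n => f n y) atTop (𝓝 (g y))) :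
    Tendsto (fun n => μ.integral Ω (f n)) atTop (𝓝 (μ.integral Ω g)) := by
  -- On `K ∩ Z` the functions need not converge, but the positive and negative contributions cancel
  -- exactly.
  have hr := SignedPair.restrict_pos_eq_restrict_neg hμ hK hKΩ hZ h0
  have hsplit : ∀ u : E N → ℝ, Measurable u → (∃ C, ∀ y, |u y| ≤ C) → (∀ y ∉ K, u y = 0) →
      (∫ y in K \ Z, u y ∂μ.pos) - ∫ y in K \ Z, u y ∂μ.neg = μ.integral Ω u := by
    intro u hu hub hu0
    have hb : IsBddSupportedOn K u := ⟨hu, hub, hu0⟩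
    rw [SignedPair.integral, setIntegral_eq_of_support_subset hΩ hKΩ hu0,
      setIntegral_eq_of_support_subset hΩ hKΩ hu0,
      ← integral_inter_add_sdiff hZ (hb.integrableOn (hμ K hKΩ hK).1),
      ← integral_inter_add_sdiff hZ (hb.integrableOn (hμ K hKΩ hK).2), hr]
    ring
  have hev : ∀ᶠ n in atTop, (∫ y in K \ Z, f n y ∂μ.pos) - ∫ y in K \ Z, f n y ∂μ.neg =
      μ.integral Ω (f n) := by
    filter_upwards [hf, hfb, hf0] with n h1 h2 h3 using hsplit _ h1 ⟨C, h2⟩ h3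
  rw [← hsplit g hg.1 hg.2 hg.3]
  refine Tendsto.congr' hev ?_
  have hm : ∀ m : Measure (E N), m K < ∞ →
      Tendsto (fun n => ∫ y in K \ Z, f n y ∂m) atTop (𝓝 (∫ y in K \ Z, g y ∂m)) := by
    intro m hm
    have : IsFiniteMeasure (m.restrict (K \ Z)) :=
      ⟨by simpa using (measure_mono sdiff_subset).trans_lt hm⟩
    refine tendsto_integral_filter_of_dominated_convergence (fun _ => C)
      (hf.mono fun n h => h.aestronglyMeasurable)
      (hfb.mono fun n h => Eventually.of_forall h) (integrable_const _) ?_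
    rw [ae_restrict_iff' (hK.measurableSet.diff hZ)]
    exact Eventually.of_forall fun y hy => hlim y hy.2
  exact (hm _ (hμ K hKΩ hK).1).sub (hm _ (hμ K hKΩ hK).2)

/-- The defining identity of the distributional derivatives extends to bounded vector fields `A`
with bounded divergence `B` that are continuous off an `ℋ^{N-1}`-null set. -/
theorem setIntegral_mul_divergence [NeZero N] {Ω K Z : Set (E N)} (hΩ : IsOpen Ω)
    (hK : IsCompact K) (hKΩ : K ⊆ Ω) (hZ : IsHausdorffNull Z) (hZm : MeasurableSet Z)
    {h : E N → ℝ} (hh : LocallyIntegrableOn h Ω volume)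
    (hb : ∀ K ⊆ Ω, IsCompact K → ∃ M : ℝ, ∀ᵐ y ∂volume, y ∈ K → |h y| ≤ M)
    {D : Fin N → SignedPair N} (hD : ∀ s, IsDistribDeriv Ω h s (D s))
    {A : Fin N → E N → ℝ} {B : E N → ℝ} (hA : ∀ s, IsBddSupportedOn K (A s))
    (hAc : ∀ s, ∀ y ∉ Z, ContinuousWithinAt (A s) Zᶜ y) (hB : IsBddSupportedOn K B)
    (hdiv : ∀ ψ : E N → ℝ, ContDiff ℝ 1 ψ →
      ∫ y, B y * ψ y = -∑ s, ∫ y, A s y * partialDeriv s ψ y) :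
    ∫ y in Ω, h y * B y = -∑ s, (D s).integral Ω (A s) := by
  obtain ⟨δ, hδ, hsub⟩ := hK.exists_cthickening_subset_open hΩ hKΩ
  -- The outer radius is a fixed multiple of the inner one, as the almost everywhere convergence of
  -- mollifications requires.
  let ρ : ℕ → ContDiffBump (0 : E N) := fun n =>
    ⟨1 / ((n : ℝ) + 1), 2 * (1 / ((n : ℝ) + 1)), by positivity, by
      have : (0 : ℝ) < 1 / ((n : ℝ) + 1) := by positivity
      linarith⟩
  have hρ : Tendsto (fun n => (ρ n).rOut) atTop (𝓝 0) := by
    simpa only [mul_zero] using (tendsto_one_div_add_atTop_nhds_zero_nat (𝕜 := ℝ)).const_mul 2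
  have hρδ : ∀ᶠ n in atTop, (ρ n).rOut ≤ δ :=
    (hρ.eventually (gt_mem_nhds hδ)).mono fun _ h => h.le
  set K' := cthickening δ K with hK'def
  have hK' : IsCompact K' := hK.cthickening
  have hKK' : K ⊆ K' := self_subset_cthickening K
  have hzero : ∀ {a : E N → ℝ}, IsBddSupportedOn K a →
      ∀ᶠ n in atTop, ∀ y ∉ K', mollify (ρ n) a y = 0 := by
    intro a ha
    filter_upwards [hρδ] with n hn y hy
    exact mollify_eq_zero ha.eq_zero fun h => hy (cthickening_mono hn K h)
  have hmeas : ∀ {a : E N → ℝ}, IsBddSupportedOn K a → ∀ n, Continuous (mollify (ρ n) a) :=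
    fun ha n => (contDiff_mollify (ha.integrable hK).locallyIntegrable).continuous
  -- the right-hand side
  have hR : Tendsto (fun n => -∑ s, (D s).integral Ω (mollify (ρ n) (A s))) atTop
      (𝓝 (-∑ s, (D s).integral Ω (A s))) := by
    refine (tendsto_finsetSum _ fun s _ => ?_).neg
    obtain ⟨C, hC⟩ := (hA s).exists_bound
    exact (hD s).1.tendsto_integral hΩ hK' hsub hZm
      (fun C hC hCc => (hD s).eval_eq_zero hΩ hb hCc ((hC.trans inter_subset_left).trans hsub)
        (measure_mono_null (hC.trans inter_subset_right) hZ))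
      (Eventually.of_forall fun n => (hmeas (hA s) n).measurable)
      (Eventually.of_forall fun n => abs_mollify_le hC) (hzero (hA s)) ((hA s).mono hKK')
      (fun y hy => tendsto_mollify hρ (hA s).measurable hZ.volume_eq_zero hZm (hAc s y hy))
  -- the left-hand side
  have hL : Tendsto (fun n => ∫ y in Ω, h y * mollify (ρ n) B y) atTop
      (𝓝 (∫ y in Ω, h y * B y)) := by
    obtain ⟨C, hC⟩ := hB.exists_bound
    have hloc : ∀ {u : E N → ℝ}, (∀ y ∉ K', u y = 0) →
        ∫ y in Ω, h y * u y = ∫ y in K', h y * u y := fun hu =>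
      setIntegral_eq_of_support_subset hΩ hsub (fun y hy => by simp [hu y hy]) _
    rw [hloc (hB.mono hKK').eq_zero]
    refine Tendsto.congr' ((hzero hB).mono fun n hn => (hloc hn).symm) ?_
    have hint := hh.integrableOn_compact_subset hsub hK'
    refine tendsto_integral_of_dominated_convergence (fun y => C * ‖h y‖)
      (fun n => hint.aestronglyMeasurable.mul (hmeas hB n).aestronglyMeasurable)
      (hint.norm.const_mul C) (fun n => Eventually.of_forall fun y => ?_) ?_
    · rw [norm_mul, mul_comm]
      exact mul_le_mul_of_nonneg_right (abs_mollify_le hC y) (norm_nonneg _)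
    · refine ae_restrict_of_ae ?_
      -- `B` has no continuity; Lebesgue differentiation suffices because it is integrated against h
      -- dy.
      have := ContDiffBump.ae_convolution_tendsto_right_of_locallyIntegrable (μ := volume) (φ := ρ)
        (K := 2) hρ (Eventually.of_forall fun n => le_rfl) (hB.integrable hK).locallyIntegrable
      filter_upwards [this] with y hy
      refine Tendsto.const_mul _ (hy.congr fun n => ?_)
      rw [mollify_eq_convolution_swap]
  refine tendsto_nhds_unique hL (hR.congr' ?_)
  filter_upwards [hρδ] with n hn
  have htest : ∀ s, IsLipTest Ω (mollify (ρ n) (A s)) := fun s =>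
    isLipTest_mollify (hA s) hK ((cthickening_mono hn K).trans hsub)
  have hint : ∀ s, IntegrableOn (fun y => h y * partialDeriv s (mollify (ρ n) (A s)) y) Ω volume :=
    fun s => ((htest s).isBddSupportedOn_partialDeriv s).integrableOn_mul_left (htest s).2.1
      (htest s).2.2 hh
  have h1 : ∀ s, -(D s).integral Ω (mollify (ρ n) (A s)) =
      ∫ y in Ω, h y * partialDeriv s (mollify (ρ n) (A s)) y := fun s => ((hD s).2 _ (htest s)).symm
  rw [← Finset.sum_neg_distrib, Finset.sum_congr rfl fun s _ => h1 s,
    ← integral_finsetSum _ fun s _ => hint s]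
  refine integral_congr_ae (Eventually.of_forall fun y => ?_)
  simp only [← Finset.mul_sum, sum_partialDeriv_mollify hK hA hdiv (ρ n) y]

/-! ### Pull-back of measures -/

section pullback

variable {F : OpenPartialHomeomorph (E N) (E N)}

theorem aemeasurable_symm (m : Measure (E N)) : AEMeasurable F.symm
    ((m.restrict F.target).withDensity fun y => ENNReal.ofReal |(fderiv ℝ F.symm y).det|) :=
  (F.continuousOn_symm.aemeasurable F.open_target.measurableSet).mono_ac
    (withDensity_absolutelyContinuous _ _)

theorem measurable_ofReal_abs_det (F : OpenPartialHomeomorph (E N) (E N)) :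
    Measurable fun y => ENNReal.ofReal |(fderiv ℝ F.symm y).det| :=
  (continuous_abs.measurable.comp (measurable_det_fderiv _)).ennreal_ofReal

/-- The transport of densities is dual to the pull-back of measures; through this duality the field
with divergence B appears in the chain rule. -/
theorem integral_pullbackMeasure {u : E N → ℝ} (hu : Measurable u) (m : Measure (E N)) :
    ∫ x, u x ∂(SignedPair.pullbackMeasure F m) = ∫ y in F.target, pushDensity F u y ∂m := by
  rw [SignedPair.pullbackMeasure, integral_map (aemeasurable_symm m) hu.aestronglyMeasurable,
    integral_withDensity_eq_integral_toReal_smul (measurable_ofReal_abs_det F)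
      (Eventually.of_forall fun _ => ENNReal.ofReal_lt_top)]
  refine setIntegral_congr_fun F.open_target.measurableSet fun y hy => ?_
  simp only [pushDensity, indicator_of_mem hy, ENNReal.toReal_ofReal (abs_nonneg _), smul_eq_mul]

theorem image_subset_target {K : Set (E N)} (hK : K ⊆ F.source) : F '' K ⊆ F.target := by
  rintro _ ⟨x, hx, rfl⟩
  exact F.map_source (hK hx)

theorem isCompact_image {K : Set (E N)} (hK : IsCompact K) (hKU : K ⊆ F.source) :
    IsCompact (F '' K) :=
  hK.image_of_continuousOn (F.continuousOn.mono hKU)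

theorem integrableOn_pushDensity (hG : LocallyLipschitzOn F.target F.symm) {K : Set (E N)}
    (hK : IsCompact K) (hKU : K ⊆ F.source) {u : E N → ℝ} (hu : IsBddSupportedOn K u)
    {m : Measure (E N)} (hm : ∀ K ⊆ F.target, IsCompact K → m K < ∞) :
    IntegrableOn (pushDensity F u) F.target m := by
  have hb := hu.pushDensity hG hK hKU
  have h1 : IntegrableOn (pushDensity F u) (F '' K) m :=
    hb.integrableOn (hm _ (image_subset_target hKU) (isCompact_image hK hKU))
  refine ((integrableOn_iff_integrable_of_support_subset fun y hy => ?_).1 h1).integrableOn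
  by_contra h
  exact hy (hb.eq_zero y h)

theorem integrable_pullbackMeasure (hG : LocallyLipschitzOn F.target F.symm) {K : Set (E N)}
    (hK : IsCompact K) (hKU : K ⊆ F.source) {u : E N → ℝ} (hu : IsBddSupportedOn K u)
    {m : Measure (E N)} (hm : ∀ K ⊆ F.target, IsCompact K → m K < ∞) :
    Integrable u (SignedPair.pullbackMeasure F m) := by
  rw [SignedPair.pullbackMeasure, integrable_map_measure hu.measurable.aestronglyMeasurable
    (aemeasurable_symm m), integrable_withDensity_iff_integrable_smul' (measurable_ofReal_abs_det F)
      (Eventually.of_forall fun _ => ENNReal.ofReal_lt_top)]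
  refine (integrableOn_pushDensity hG hK hKU hu hm).congr_fun (fun y hy => ?_)
    F.open_target.measurableSet
  simp only [pushDensity, indicator_of_mem hy, ENNReal.toReal_ofReal (abs_nonneg _), smul_eq_mul,
    Function.comp_apply]

variable {k : E N → ℝ}

theorem IsBddSupportedOn.mul_max {K : Set (E N)} {u : E N → ℝ} (hu : IsBddSupportedOn K u)
    (hk : Measurable k) (hkb : ∃ C, ∀ x ∈ K, |k x| ≤ C) :
    IsBddSupportedOn K fun x => u x * max (k x) 0 := by
  refine hu.mul (hk.max measurable_const) ?_
  obtain ⟨C, hC⟩ := hkb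
  exact ⟨C, fun x hx => (abs_max_le_max_abs_abs.trans (by simp)).trans (hC x hx)⟩

theorem integral_withDensity_pullbackMeasure {u : E N → ℝ} (hu : Measurable u) (hk : Measurable k)
    (m : Measure (E N)) :
    ∫ x, u x ∂((SignedPair.pullbackMeasure F m).withDensity fun x => ENNReal.ofReal (k x)) =
      ∫ y in F.target, pushDensity F (fun x => u x * max (k x) 0) y ∂m := by
  have h1 := integral_pullbackMeasure (F := F) (u := fun x => u x * max (k x) 0)
    (hu.mul (hk.max measurable_const)) m
  rw [← h1, integral_withDensity_eq_integral_toReal_smul hk.ennreal_ofReal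
      (Eventually.of_forall fun _ => ENNReal.ofReal_lt_top)]
  refine integral_congr_ae (Eventually.of_forall fun x => ?_)
  simp only [smul_eq_mul, ENNReal.toReal_ofReal', mul_comm]

theorem integrable_withDensity_pullbackMeasure (hG : LocallyLipschitzOn F.target F.symm)
    {K : Set (E N)} (hK : IsCompact K) (hKU : K ⊆ F.source) {u : E N → ℝ}
    (hu : IsBddSupportedOn K u) (hk : Measurable k) (hkb : ∃ C, ∀ x ∈ K, |k x| ≤ C)
    {m : Measure (E N)} (hm : ∀ K ⊆ F.target, IsCompact K → m K < ∞) :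
    Integrable u
      ((SignedPair.pullbackMeasure F m).withDensity fun x => ENNReal.ofReal (k x)) := by
  rw [integrable_withDensity_iff_integrable_smul' hk.ennreal_ofReal
      (Eventually.of_forall fun _ => ENNReal.ofReal_lt_top)]
  refine (integrable_pullbackMeasure hG hK hKU (hu.mul_max hk hkb) hm).congr
    (Eventually.of_forall fun x => ?_)
  simp only [smul_eq_mul, ENNReal.toReal_ofReal', mul_comm]

theorem withDensity_pullbackMeasure_lt_top (hG : LocallyLipschitzOn F.target F.symm)
    {K : Set (E N)} (hK : IsCompact K) (hKU : K ⊆ F.source)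
    (hk : Measurable k) (hkb : ∃ C, ∀ x ∈ K, |k x| ≤ C)
    {m : Measure (E N)} (hm : ∀ K ⊆ F.target, IsCompact K → m K < ∞) :
    ((SignedPair.pullbackMeasure F m).withDensity fun x => ENNReal.ofReal (k x)) K < ∞ := by
  -- Finiteness on `K` is read off from integrability of its indicator.
  have hb : IsBddSupportedOn K (K.indicator fun _ => (1 : ℝ)) := by
    refine ⟨measurable_const.indicator hK.measurableSet, ⟨1, fun y => ?_⟩,
      fun y hy => indicator_of_notMem hy _⟩
    by_cases hy : y ∈ K <;> simp [hy]
  have := integrable_withDensity_pullbackMeasure hG hK hKU hb hk hkb hm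
  rw [integrable_indicator_iff hK.measurableSet, integrableOn_const_iff] at this
  exact this.resolve_left (by simp)

/-- The product of a locally bounded function with the pull-back of a signed Radon measure is a
signed Radon measure. -/
theorem SignedPair.IsRadonOn.mulFun_pullback (hG : LocallyLipschitzOn F.target F.symm)
    {μ : SignedPair N} (hμ : μ.IsRadonOn F.target) (hk : Measurable k)
    (hkb : ∀ K ⊆ F.source, IsCompact K → ∃ C, ∀ x ∈ K, |k x| ≤ C) :
    (SignedPair.mulFun k (SignedPair.pullback F μ)).IsRadonOn F.source := by
  intro K hKU hK
  have hp := fun K h h' => (hμ K h h').1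
  have hn := fun K h h' => (hμ K h h').2
  have hkb' : ∃ C, ∀ x ∈ K, |(-k x)| ≤ C := by simpa only [abs_neg] using hkb K hKU hK
  simp only [mulFun, pullback, Measure.add_apply, ENNReal.add_lt_top]
  exact ⟨⟨withDensity_pullbackMeasure_lt_top hG hK hKU hk (hkb K hKU hK) hp,
    withDensity_pullbackMeasure_lt_top hG hK hKU hk.neg hkb' hn⟩,
    ⟨withDensity_pullbackMeasure_lt_top hG hK hKU hk.neg hkb' hp,
    withDensity_pullbackMeasure_lt_top hG hK hKU hk (hkb K hKU hK) hn⟩⟩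

theorem SignedPair.IsRadonOn.sum {Ω : Set (E N)} {μ : Fin N → SignedPair N}
    (hμ : ∀ s, (μ s).IsRadonOn Ω) : (SignedPair.sum μ).IsRadonOn Ω := by
  intro K hKΩ hK
  simp only [SignedPair.sum, Measure.coe_finsetSum, Finset.sum_apply, ENNReal.sum_lt_top]
  exact ⟨fun s _ => (hμ s K hKΩ hK).1, fun s _ => (hμ s K hKΩ hK).2⟩

theorem integral_sum_of_isBddSupportedOn {Ω K : Set (E N)} (hΩ : IsOpen Ω) (hK : IsCompact K)
    (hKΩ : K ⊆ Ω) {u : E N → ℝ} (hu : IsBddSupportedOn K u) {μ : Fin N → SignedPair N}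
    (hμ : ∀ s, (μ s).IsRadonOn Ω) :
    (SignedPair.sum μ).integral Ω u = ∑ s, (μ s).integral Ω u := by
  have h1 : ∀ m : Measure (E N), ∫ x in Ω, u x ∂m = ∫ x in K, u x ∂m := fun m =>
    setIntegral_eq_of_support_subset hΩ hKΩ hu.eq_zero m
  have h2 : ∀ m : Measure (E N), ∫ x in Ω, u x ∂m = ∫ x, u x ∂m := fun m =>
    setIntegral_eq_integral_of_forall_compl_eq_zero fun x hx => hu.eq_zero x fun h => hx (hKΩ h)
  have h3 : ∀ m : Measure (E N), m K < ∞ → Integrable u m := fun m hm =>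
    (integrableOn_iff_integrable_of_support_subset fun y hy => by
      by_contra h
      exact hy (hu.eq_zero y h)).1 (hu.integrableOn hm)
  simp only [SignedPair.integral, SignedPair.sum, h2]
  rw [integral_finsetSum_measure fun s _ => h3 _ (hμ s K hKΩ hK).1,
    integral_finsetSum_measure fun s _ => h3 _ (hμ s K hKΩ hK).2, Finset.sum_sub_distrib]

/-- The four densities recombine through k = k⁺ - k⁻; each piece is integrable because `u` is
bounded with support in `K`, where `k` is bounded. -/
theorem integral_mulFun_pullback (hG : LocallyLipschitzOn F.target F.symm)
    {μ : SignedPair N} (hμ : μ.IsRadonOn F.target) (hk : Measurable k) {K : Set (E N)}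
    (hK : IsCompact K) (hKU : K ⊆ F.source)
    (hkb : ∃ C, ∀ x ∈ K, |k x| ≤ C) {u : E N → ℝ} (hu : IsBddSupportedOn K u) :
    (SignedPair.mulFun k (SignedPair.pullback F μ)).integral F.source u =
      μ.integral F.target (pushDensity F fun x => u x * k x) := by
  have hp := fun K h h' => (hμ K h h').1
  have hn := fun K h h' => (hμ K h h').2
  have hkb' : ∃ C, ∀ x ∈ K, |(-k x)| ≤ C := by simpa only [abs_neg] using hkb
  have h2 : ∀ m : Measure (E N), ∫ x in F.source, u x ∂m = ∫ x, u x ∂m := fun m =>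
    setIntegral_eq_integral_of_forall_compl_eq_zero fun x hx => hu.eq_zero x fun h => hx (hKU h)
  have hkn : Measurable fun x => -k x := hk.neg
  have hadd : ∀ y, pushDensity F (fun x => u x * k x) y =
      pushDensity F (fun x => u x * max (k x) 0) y -
        pushDensity F (fun x => u x * max (-k x) 0) y := by
    intro y
    by_cases hy : y ∈ F.target
    · simp only [pushDensity, indicator_of_mem hy, ← mul_sub]
      rw [max_zero_sub_max_neg_zero_eq_self]
    · simp [pushDensity, hy]
  have hsplit : ∀ m : Measure (E N), (∀ K ⊆ F.target, IsCompact K → m K < ∞) →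
      ∫ y in F.target, pushDensity F (fun x => u x * k x) y ∂m =
        (∫ y in F.target, pushDensity F (fun x => u x * max (k x) 0) y ∂m) -
          ∫ y in F.target, pushDensity F (fun x => u x * max (-k x) 0) y ∂m := by
    intro m hm
    simp_rw [hadd]
    exact integral_sub (integrableOn_pushDensity hG hK hKU (hu.mul_max hk hkb) hm)
      (integrableOn_pushDensity hG hK hKU (hu.mul_max hkn hkb') hm)
  simp only [SignedPair.integral, SignedPair.mulFun, SignedPair.pullback, h2]
  rw [integral_add_measure (integrable_withDensity_pullbackMeasure hG hK hKU hu hk hkb hp)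
      (integrable_withDensity_pullbackMeasure hG hK hKU hu hkn hkb' hn),
    integral_add_measure (integrable_withDensity_pullbackMeasure hG hK hKU hu hkn hkb' hp)
      (integrable_withDensity_pullbackMeasure hG hK hKU hu hk hkb hn),
    integral_withDensity_pullbackMeasure hu.measurable hk,
    integral_withDensity_pullbackMeasure hu.measurable hk,
    integral_withDensity_pullbackMeasure hu.measurable hkn,
    integral_withDensity_pullbackMeasure hu.measurable hkn, hsplit _ hp, hsplit _ hn]
  ring

end pullback

/-! ### The chain rule -/

theorem IsHausdorffNull.iUnion {ι : Type*} [Countable ι] {S : ι → Set (E N)}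
    (hS : ∀ i, IsHausdorffNull (S i)) : IsHausdorffNull (⋃ i, S i) :=
  measure_iUnion_null hS

section transition

variable {F : OpenPartialHomeomorph (E N) (E N)}

theorem IsDC0Transition.locallyLipschitzOn (hF : IsDC0Transition F) :
    LocallyLipschitzOn F.source F :=
  locallyLipschitzOn_of_components fun s => (hF.1 s).1.locallyLipschitzOn

theorem IsDC0Transition.locallyLipschitzOn_symm (hF : IsDC0Transition F) :
    LocallyLipschitzOn F.target F.symm :=
  locallyLipschitzOn_of_components fun s => (hF.2 s).1.locallyLipschitzOn

/-- The transported fields are continuous off a common `ℋ^{N-1}`-null Borel set. -/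
theorem IsDC0Transition.exists_null_continuousWithinAt [NeZero N] (hF : IsDC0Transition F) :
    ∃ Z, IsHausdorffNull Z ∧ MeasurableSet Z ∧ ∀ φ, IsLipTest F.source φ → ∀ i s, ∀ y ∉ Z,
      ContinuousWithinAt
        (pushDensity F fun x => φ x * partialDeriv i (fun x => F x s) x) Zᶜ y := by
  have hFl := hF.locallyLipschitzOn
  have hGl := hF.locallyLipschitzOn_symm
  choose S hS0 hSc using fun s => (hF.1 s).2
  choose T hT0 hTc using fun s => (hF.2 s).2
  -- Lipschitz images control Hausdorff measure only for nonnegative exponents.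
  have hN : (0 : ℝ) ≤ (N : ℝ) - 1 := by
    have : (1 : ℝ) ≤ N := by exact_mod_cast NeZero.one_le
    linarith
  have h1 : IsHausdorffNull (F '' ((⋃ s, S s) ∩ F.source)) :=
    hausdorffMeasure_image_eq_zero hN hFl inter_subset_right
      (measure_mono_null inter_subset_left (IsHausdorffNull.iUnion hS0))
  have h2 : IsHausdorffNull (F '' ((⋃ s, S s) ∩ F.source) ∪ ⋃ s, T s) :=
    measure_union_null h1 (IsHausdorffNull.iUnion hT0)
  -- The image of the exceptional sets of ∂F controls the factors ∂_iF_s ∘ F⁻¹, those of ∂F⁻¹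
  -- control the determinant. A Borel hull makes the union measurable.
  obtain ⟨Z, hZsub, hZm, hZ0⟩ := exists_measurable_superset_of_null h2
  refine ⟨Z, hZ0, hZm, fun φ hφ i s y hy => ?_⟩
  by_cases hyV : y ∈ F.target
  · have hdet : ContinuousOn (fun y => (fderiv ℝ F.symm y).det) (F.target \ ⋃ s, T s) :=
      continuousOn_det_fderiv fun s i => ((hTc s i).1.mono
        (sdiff_subset_sdiff_right (subset_iUnion T s)))
    have hVZ : F.target ∩ Zᶜ ⊆ F.target \ ⋃ s, T s := fun z hz =>
      ⟨hz.1, fun h => hz.2 (hZsub (Or.inr h))⟩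
    have hmaps : MapsTo F.symm (F.target ∩ Zᶜ) (F.source \ S s) := fun z hz =>
      ⟨F.map_target hz.1, fun h => hz.2 (hZsub (Or.inl ⟨F.symm z,
        ⟨mem_iUnion.2 ⟨s, h⟩, F.map_target hz.1⟩, F.right_inv hz.1⟩))⟩
    have hGc : ContinuousOn F.symm (F.target ∩ Zᶜ) := F.continuousOn_symm.mono inter_subset_left
    have hcont : ContinuousOn (fun y => |(fderiv ℝ F.symm y).det| *
        (φ (F.symm y) * partialDeriv i (fun x => F x s) (F.symm y))) (F.target ∩ Zᶜ) := by
      refine (hdet.mono hVZ).abs.mul (ContinuousOn.mul ?_ ((hSc s i).1.comp hGc hmaps))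
      exact hφ.1.choose_spec.continuous.comp_continuousOn hGc
    have hnhds : 𝓝[F.target ∩ Zᶜ] y = 𝓝[Zᶜ] y :=
      nhdsWithin_inter_of_mem (mem_nhdsWithin_of_mem_nhds (F.open_target.mem_nhds hyV))
    have h3 : ContinuousWithinAt (pushDensity F fun x => φ x * partialDeriv i (fun x => F x s) x)
        (F.target ∩ Zᶜ) y :=
      (hcont y ⟨hyV, hy⟩).congr (fun z hz => indicator_of_mem hz.1 _) (indicator_of_mem hyV _)
    rwa [ContinuousWithinAt, hnhds] at h3
  -- Off the target the field vanishes in a neighbourhood, since it is supported in a compact subset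
  -- of the target.
  · have hb := (hφ.isBddSupportedOn_mul_partialDeriv hFl i s).pushDensity hGl hφ.2.1 hφ.2.2
    have hyK : y ∉ F '' tsupport φ := fun h => hyV (image_subset_target hφ.2.2 h)
    have hopen := (isCompact_image hφ.2.1 hφ.2.2).isClosed.isOpen_compl.mem_nhds hyK
    refine ContinuousAt.continuousWithinAt (continuousAt_const.congr (f := fun _ => (0 : ℝ)) ?_)
    filter_upwards [hopen] with z hz
    exact (hb.eq_zero z hz).symm

theorem IsDC0Transition.exists_bound_partialDeriv (hF : IsDC0Transition F) (i s : Fin N)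
    {K : Set (E N)} (hKU : K ⊆ F.source) (hK : IsCompact K) :
    ∃ C, ∀ x ∈ K, |partialDeriv i (fun x => F x s) x| ≤ C := by
  obtain ⟨C, -, hC⟩ := DCCalculus.exists_bound_partialDeriv F.open_source
    (hF.1 s).1.locallyLipschitzOn hK hKU i
  exact ⟨C, hC⟩

theorem IsDC0Transition.isRadonOn_sum (hF : IsDC0Transition F) {D : Fin N → SignedPair N}
    (hD : ∀ s, (D s).IsRadonOn F.target) (i : Fin N) :
    (SignedPair.sum fun s => SignedPair.mulFun (partialDeriv i fun x => F x s)
      (SignedPair.pullback F (D s))).IsRadonOn F.source :=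
  SignedPair.IsRadonOn.sum fun s => (hD s).mulFun_pullback hF.locallyLipschitzOn_symm
    (measurable_partialDeriv i _) fun _ h h' => hF.exists_bound_partialDeriv i s h h'

/-- The chain rule for geometric `BV` functions under `DC_0` transition maps. -/
theorem IsDC0Transition.isDistribDeriv_comp [NeZero N] (hF : IsDC0Transition F) {h : E N → ℝ}
    (hh : MemGeomBV F.target h) {D : Fin N → SignedPair N}
    (hD : ∀ s, IsDistribDeriv F.target h s (D s)) (i : Fin N) :
    IsDistribDeriv F.source (h ∘ F) i
      (SignedPair.sum fun s => SignedPair.mulFun (partialDeriv i fun x => F x s)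
        (SignedPair.pullback F (D s))) := by
  have hFl := hF.locallyLipschitzOn
  have hGl := hF.locallyLipschitzOn_symm
  refine ⟨hF.isRadonOn_sum (fun s => (hD s).1) i, fun φ hφ => ?_⟩
  obtain ⟨Z, hZ0, hZm, hZc⟩ := hF.exists_null_continuousWithinAt
  have hφs := hφ.isBddSupportedOn
  rw [integral_sum_of_isBddSupportedOn F.open_source hφ.2.1 hφ.2.2 hφs fun s =>
    (hD s).1.mulFun_pullback hGl (measurable_partialDeriv i _)
      fun _ h h' => hF.exists_bound_partialDeriv i s h h']
  simp_rw [fun s => integral_mulFun_pullback hGl (hD s).1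
    (measurable_partialDeriv i fun x => F x s) hφ.2.1 hφ.2.2
    (hF.exists_bound_partialDeriv i s hφ.2.2 hφ.2.1) hφs]
  rw [← setIntegral_mul_divergence F.open_target (isCompact_image hφ.2.1 hφ.2.2)
    (image_subset_target hφ.2.2) hZ0 hZm hh.1.1 (fun K hK hKc => hh.2.exists_ae_bound hK hKc) hD
    (fun s => (hφ.isBddSupportedOn_mul_partialDeriv hFl i s).pushDensity hGl hφ.2.1 hφ.2.2)
    (fun s y hy => hZc φ hφ i s y hy)
    ((hφ.isBddSupportedOn_partialDeriv i).pushDensity hGl hφ.2.1 hφ.2.2)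
    (fun ψ hψ => integral_pushDensity_divergence hFl hGl hφ i hψ)]
  exact (setIntegral_mul_pushDensity hGl h (partialDeriv i φ)).symm

theorem IsDC0Transition.memBVloc_comp (hF : IsDC0Transition F) {h : E N → ℝ}
    (hh : MemGeomBV F.target h) : MemBVloc F.source (h ∘ F) := by
  refine ⟨locallyIntegrableOn_comp hF.locallyLipschitzOn_symm hh.1.1, fun i => ?_⟩
  -- Dimension zero has no coordinate index.
  have : NeZero N := ⟨fun h0 => by subst h0; exact i.elim0⟩
  choose D hD using hh.1.2
  exact ⟨_, hF.isDistribDeriv_comp hh hD i⟩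

end transition

end DCCalculus

end

theorem corollary3p6 {N : ℕ}
    (F : OpenPartialHomeomorph (DCCalculus.E N) (DCCalculus.E N))
    (hF : DCCalculus.IsDC0Transition F)
    (h : DCCalculus.E N → ℝ) (hh : DCCalculus.MemGeomBV F.target h) :
    DCCalculus.MemBVloc F.source (h ∘ F) ∧
    ∀ Dh : Fin N → DCCalculus.SignedPair N,
      (∀ s, DCCalculus.IsDistribDeriv F.target h s (Dh s)) →
      ∀ i : Fin N,
        (DCCalculus.SignedPair.sum fun s =>
          DCCalculus.SignedPair.mulFun (DCCalculus.partialDeriv i fun x => F x s)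
            (DCCalculus.SignedPair.pullback F (Dh s))).IsRadonOn F.source ∧
        ∀ μ : DCCalculus.SignedPair N,
          DCCalculus.IsDistribDeriv F.source (h ∘ F) i μ →
          μ.EqOn F.source
            (DCCalculus.SignedPair.sum fun s =>
              DCCalculus.SignedPair.mulFun (DCCalculus.partialDeriv i fun x => F x s)
                (DCCalculus.SignedPair.pullback F (Dh s))) := by
  refine ⟨hF.memBVloc_comp hh, fun Dh hDh i => ?_⟩
  have : NeZero N := ⟨fun h0 => by subst h0; exact i.elim0⟩
  have hd := hF.isDistribDeriv_comp hh hDh i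
  refine ⟨hd.1, fun μ hμ => ?_⟩
  -- Both measures pair with φ to -∫ (h ∘ F) ∂_iφ.
  refine DCCalculus.SignedPair.eqOn_of_forall_integral_eq F.open_source hμ.1 hd.1 fun φ hφ => ?_
  exact neg_injective ((hμ.2 φ hφ).symm.trans (hd.2 φ hφ))
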